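/- Let $n\ge 1$ and let $a_1,\dots,a_n$ be nonzero integers that are multiplicatively independent modulo squares, i.e. for every nonempty $\mathcal J\subseteq\{1,\dots,n\}$ the product $b_{\mathcal J}=\prod_{j\in\mathcal J}a_j$ is not the square of an integer. Write $\operatorname{Discr}K$ for the (signed) discriminant over $\mathbb Q$ of a number field $K$. Then $$\operatorname{Discr}\mathbb Q(\sqrt{a_1},\dots,\sqrt{a_n})=\prod_{\substack{\mathcal J\subseteq\{1,\dots,n\}\\ \mathcal J\ne\varnothing}}\operatorname{Discr}\mathbb Q\bigl(\sqrt{b_{\mathcal J}}\bigr).$$ Moreover, if $n\ge 2$, or if all $a_i$ are positive, then this discriminant is positive. -/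

import Mathlib

/-- The field `ℚ(√b) ⊆ ℂ`, generated over `ℚ` by the complex square roots `±√b` of the integer `b`.
Since `-√b` lies in the field generated by `√b`, no choice of a root is needed. -/
noncomputable def quadraticField (b : ℤ) : IntermediateField ℚ ℂ :=
  IntermediateField.adjoin ℚ {z : ℂ | z ^ 2 = (b : ℂ)}

/-- The field `ℚ(√a₁, …, √aₙ) ⊆ ℂ`, generated over `ℚ` by the complex square roots `±√aᵢ` of the
integers `a₁, …, aₙ`. -/
noncomputable def multiquadraticField {n : ℕ} (a : Fin n → ℤ) : IntermediateField ℚ ℂ :=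
  IntermediateField.adjoin ℚ {z : ℂ | ∃ i, z ^ 2 = (a i : ℂ)}

/-- The product `b_J = ∏_{j ∈ J} a_j`. -/
def subsetProd {n : ℕ} (a : Fin n → ℤ) (J : Finset (Fin n)) : ℤ :=
  ∏ j ∈ J, a j

/-- `a₁, …, aₙ` are multiplicatively independent modulo squares: no product `b_J` with `J ≠ ∅` is
the square of an integer. -/
def MultIndepModSquares {n : ℕ} (a : Fin n → ℤ) : Prop :=
  ∀ J : Finset (Fin n), J.Nonempty → ¬ IsSquare (subsetProd a J)

theorem finite_sqrt_set (b : ℤ) : {z : ℂ | z ^ 2 = (b : ℂ)}.Finite := by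
  obtain ⟨w, hw⟩ := IsAlgClosed.exists_pow_nat_eq (b : ℂ) (n := 2) (by norm_num)
  refine Set.Finite.subset (Set.toFinite {w, -w}) ?_
  intro z hz
  have h : z ^ 2 = w ^ 2 := by rw [hw]; exact hz
  simpa using sq_eq_sq_iff_eq_or_eq_neg.mp h

theorem isIntegral_of_sq_eq_intCast {z : ℂ} {b : ℤ} (hz : z ^ 2 = (b : ℂ)) : IsIntegral ℚ z := by
  refine IsIntegral.of_pow (n := 2) (by norm_num) ?_
  rw [hz]
  simpa using (isIntegral_algebraMap (R := ℚ) (A := ℂ) (x := (b : ℚ)))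

instance quadraticField.numberField (b : ℤ) : NumberField (quadraticField b) where
  to_charZero := inferInstance
  to_finiteDimensional := by
    have := (finite_sqrt_set b).to_subtype
    exact IntermediateField.finiteDimensional_adjoin fun z hz => isIntegral_of_sq_eq_intCast hz

instance multiquadraticField.numberField {n : ℕ} (a : Fin n → ℤ) :
    NumberField (multiquadraticField a) where
  to_charZero := inferInstance
  to_finiteDimensional := by
    have hfin : {z : ℂ | ∃ i, z ^ 2 = (a i : ℂ)}.Finite := by
      rw [Set.ofPred_exists]
      exact Set.finite_iUnion fun i => finite_sqrt_set (a i)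
    have := hfin.to_subtype
    refine IntermediateField.finiteDimensional_adjoin ?_
    rintro z ⟨i, hz⟩
    exact isIntegral_of_sq_eq_intCast hz

/-! The two sides are compared prime by prime and then in sign. Fix a prime p. Suppose some
quadratic subfield ℚ(√b_J) is unramified at p, and choose i ∈ J. Then √b_J can replace √a_i as a
generator, and the field is a linearly disjoint compositum of ℚ(√a_j : j ≠ i) with a quadratic field
unramified at p. Hence the exponent of p in its discriminant is twice that of the smaller field
(`padicValInt_discr_sqrtField_insert`). The product over subsets behaves alike: exactly one of J'
and J ∆ J' contains i, and their quadratic fields have the same exponent at p, since multiplication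
by b_J does not change it (`padicValInt_discr_sqrtField_mul`). Induction on the number of generators
(`padicValInt_discr_sqrtField_image`) leaves the case where every quadratic subfield ramifies at p.

That case is small. For odd p, the product of two of the a_i is prime to p up to squares, so n ≤ 1
(`card_le_one_of_odd_of_forall_dvd`). For p = 2, residues mod 4 force n ≤ 2, and n = 2 means ℚ(√u,
√(2w)) with u ≡ 3 mod 4 and w odd. There an explicit Eisenstein generator gives exponent 8 = 2 + 3 +
3 (`padicValInt_two_discr_biquadratic`).

As to signs, for n ≥ 2 both sides are positive: the field is totally real or has 2^(n-1) complex
places, while discr ℚ(√b) has the sign of b and each a_i divides out of exactly 2^(n-1) of the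
products b_J. -/

/-! ### Discriminants via differents: composita and Eisenstein generators -/

section DiscriminantTools
open NumberField Module Polynomial

/-- If `L = F₁F₂` with `F₁`, `F₂` linearly disjoint, then `|discr L|` is `|discr F₁| ^ [L : F₁]`
times a divisor of `|discr F₂| ^ [L : F₂]`. -/
theorem exists_natAbs_discr_eq_mul_of_linearDisjoint {L : Type*} [Field L] [NumberField L]
    {F₁ F₂ : IntermediateField ℚ L} (h₁ : F₁.LinearDisjoint F₂) (h₂ : F₁ ⊔ F₂ = ⊤) :
    ∃ m : ℕ, m ∣ (discr F₂).natAbs ^ finrank ℚ F₁ ∧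
      (discr L).natAbs = m * (discr F₁).natAbs ^ finrank ℚ F₂ := by
  let _ : Algebra (FractionRing (𝓞 F₁)) (FractionRing (𝓞 L)) := FractionRing.liftAlgebra _ _
  -- The factor is the norm of the relative different of L/F₁. By disjointness this different
  -- divides the extension to L of the different of F₂; the tower formula gives the equality.
  refine ⟨Ideal.absNorm (differentIdeal (𝓞 F₁) (𝓞 L)), ?_, ?_⟩
  · have h := IsDedekindDomain.differentIdeal_dvd_map_differentIdeal ℤ (𝓞 L) (𝓞 F₁) (𝓞 F₂) h₁ h₂
    have h' := map_dvd Ideal.absNorm h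
    rwa [Ideal.absNorm_algebraMap, absNorm_differentIdeal F₂,
      ← IsFractionRing.finrank_eq (𝓞 F₂) F₂ (𝓞 L) L, h₁.finrank_right_eq_finrank h₂] at h'
  · have := natAbs_discr_eq_absNorm_differentIdeal_mul_natAbs_discr_pow F₁ (𝓞 F₁) L (𝓞 L)
    rwa [h₁.finrank_left_eq_finrank h₂] at this

/-- The factor coming from F₂ divides a power of `discr F₂`, hence is prime to p. The ℚ-algebra
structure `alg` is left free so that the lemma applies to the one carried by an intermediate field.
-/
theorem padicValInt_discr_of_linearDisjoint {L : Type*} [Field L] [NumberField L] [alg : Algebra ℚ L]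
    {p : ℕ} (hp : p.Prime) {F₁ F₂ : IntermediateField ℚ L} (h₁ : F₁.LinearDisjoint F₂) (h₂ : F₁ ⊔ F₂ = ⊤)
    (h : ¬ (p : ℤ) ∣ discr F₂) :
    padicValInt p (discr L) = finrank ℚ F₂ * padicValInt p (discr F₁) := by
  obtain rfl : alg = DivisionRing.toRatAlgebra := Subsingleton.elim _ _
  have := Fact.mk hp
  obtain ⟨m, hm, hd⟩ := exists_natAbs_discr_eq_mul_of_linearDisjoint h₁ h₂
  have hpm : ¬ p ∣ m := fun hpm => h <| Int.natCast_dvd.mpr <| hp.dvd_of_dvd_pow (hpm.trans hm)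
  have hm0 : m ≠ 0 := by rintro rfl; simp at hpm
  rw [padicValInt, hd, padicValNat.mul hm0 (pow_ne_zero _ (by simpa using discr_ne_zero F₁)),
    padicValNat.eq_zero_of_not_dvd hpm, zero_add,
    padicValNat.pow, padicValInt]

/-- The ring isomorphism between an intermediate field and its copy inside a larger one. -/
noncomputable def restrictRingEquiv {k Ω : Type*} [Field k] [Field Ω] [Algebra k Ω]
    {E F : IntermediateField k Ω} (h : E ≤ F) : E ≃+* IntermediateField.restrict h :=
  (IntermediateField.restrictAlgEquiv h).toRingEquiv

theorem finrank_restrict {k Ω : Type*} [Field k] [Field Ω] [Algebra k Ω]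
    {E F : IntermediateField k Ω} (h : E ≤ F) :
    finrank k (IntermediateField.restrict h) = finrank k E :=
  (IntermediateField.restrictAlgEquiv h).symm.toLinearEquiv.finrank_eq

theorem restrict_sup_restrict {k Ω : Type*} [Field k] [Field Ω] [Algebra k Ω]
    (E F : IntermediateField k Ω) : IntermediateField.restrict (le_sup_left : E ≤ E ⊔ F) ⊔
      IntermediateField.restrict (le_sup_right : F ≤ E ⊔ F) = ⊤ := by
  apply IntermediateField.lift_injective
  rw [IntermediateField.lift_sup, IntermediateField.lift_restrict,
    IntermediateField.lift_restrict, IntermediateField.lift_top]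

theorem linearDisjoint_restrict {k Ω : Type*} [Field k] [Field Ω] [Algebra k Ω]
    {E F : IntermediateField k Ω} [FiniteDimensional k E] [FiniteDimensional k F]
    (h : finrank k ↥(E ⊔ F) = finrank k E * finrank k F) :
    (IntermediateField.restrict (le_sup_left : E ≤ E ⊔ F)).LinearDisjoint
      (IntermediateField.restrict (le_sup_right : F ≤ E ⊔ F)) := by
  apply IntermediateField.LinearDisjoint.of_finrank_sup
  rw [restrict_sup_restrict, IntermediateField.finrank_top', h, finrank_restrict, finrank_restrict]

theorem padicValInt_discr_sup {Ω : Type*} [Field Ω] [Algebra ℚ Ω] {p : ℕ} (hp : p.Prime)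
    (E F : IntermediateField ℚ Ω) [NumberField E] [NumberField F] [NumberField ↥(E ⊔ F)]
    [FiniteDimensional ℚ E] [FiniteDimensional ℚ F]
    (hrank : finrank ℚ ↥(E ⊔ F) = finrank ℚ E * finrank ℚ F) (h : ¬ (p : ℤ) ∣ discr F) :
    padicValInt p (discr ↥(E ⊔ F)) = finrank ℚ F * padicValInt p (discr E) := by
  rw [discr_eq_discr_of_ringEquiv E (restrictRingEquiv (le_sup_left : E ≤ E ⊔ F)),
    ← finrank_restrict (le_sup_right : F ≤ E ⊔ F)]
  refine padicValInt_discr_of_linearDisjoint (alg := (E ⊔ F).algebra') hp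
    (linearDisjoint_restrict hrank) (restrict_sup_restrict E F) ?_
  rwa [← discr_eq_discr_of_ringEquiv F (restrictRingEquiv (le_sup_right : F ≤ E ⊔ F))]

variable {K : Type*} [Field K] [NumberField K]

theorem adjoin_eq_top_of_natDegree_minpoly {x : 𝓞 K} (h : (minpoly ℤ x).natDegree = finrank ℚ K) :
    Algebra.adjoin ℚ {algebraMap (𝓞 K) K x} = ⊤ := by
  have hx : IsIntegral ℤ (algebraMap (𝓞 K) K x) := x.isIntegral_coe
  rw [← IntermediateField.adjoin_simple_toSubalgebra_of_isAlgebraic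
    (Algebra.IsAlgebraic.isAlgebraic _), ← IntermediateField.top_toSubalgebra]
  congr 1
  rw [Field.primitive_element_iff_minpoly_natDegree_eq,
    minpoly.isIntegrallyClosed_eq_field_fractions' ℚ hx, (minpoly.monic hx).natDegree_map, ← h]
  congr 1
  exact minpoly.algebraMap_eq (FaithfulSMul.algebraMap_injective (𝓞 K) K) x

theorem minpoly_eq_of_irreducible {x : 𝓞 K} {f : ℤ[X]} (hf : f.Monic) (hirr : Irreducible f)
    (hx : aeval x f = 0) : minpoly ℤ x = f := by
  have hd := minpoly.isIntegrallyClosed_dvd (Algebra.IsIntegral.isIntegral x) hx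
  refine eq_of_monic_of_associated (minpoly.monic (Algebra.IsIntegral.isIntegral x)) hf ?_
  exact (hirr.dvd_iff.mp hd).resolve_left (minpoly.not_isUnit ℤ x) |>.symm

/-- The element f'(x) lies in the different, so m does too. Taking norms, `discr K` divides a power
of m. -/
theorem not_dvd_discr_of_dvd_aeval_derivative {x : 𝓞 K} {f : ℤ[X]} (hf : f.Monic)
    (hirr : Irreducible f) (hdeg : f.natDegree = finrank ℚ K) (hx : aeval x f = 0) {p : ℕ}
    (hp : p.Prime) {m : ℤ} (hm : aeval x (derivative f) ∣ (m : 𝓞 K)) (hpm : ¬ (p : ℤ) ∣ m) :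
    ¬ (p : ℤ) ∣ discr K := by
  have hmin := minpoly_eq_of_irreducible hf hirr hx
  have hmem := aeval_derivative_mem_differentIdeal ℤ ℚ K x
    (adjoin_eq_top_of_natDegree_minpoly (by rw [hmin, hdeg]))
  rw [hmin] at hmem
  have hmem' : (m : 𝓞 K) ∈ differentIdeal ℤ (𝓞 K) := Ideal.mem_of_dvd _ hm hmem
  have hdvd := Ideal.absNorm_dvd_absNorm_of_le ((Ideal.span_singleton_le_iff_mem _).mpr hmem')
  rw [absNorm_differentIdeal K, Ideal.absNorm_span_singleton, ← eq_intCast (algebraMap ℤ (𝓞 K)),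
    Algebra.norm_algebraMap, Int.natAbs_pow] at hdvd
  intro h
  exact hpm (Int.natCast_dvd.mpr (hp.dvd_of_dvd_pow ((Int.natCast_dvd.mp h).trans hdvd)))

theorem not_dvd_norm_of_dvd {p : ℕ} (hp : p.Prime) {y : 𝓞 K} {m : ℤ} (hy : y ∣ (m : 𝓞 K))
    (hpm : ¬ (p : ℤ) ∣ m) : ¬ (p : ℤ) ∣ Algebra.norm ℤ y := by
  intro h
  have h' := map_dvd (Algebra.norm ℤ) hy
  rw [← eq_intCast (algebraMap ℤ (𝓞 K)), Algebra.norm_algebraMap] at h'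
  exact hpm ((Nat.prime_iff_prime_int.mp hp).dvd_of_dvd_pow (h.trans h'))

/-- If `x` generates `K` and its minimal polynomial is Eisenstein at `p`, the conductor of `ℤ[x]`
contains an integer prime to `p`. -/
theorem exists_mem_conductor_of_isEisensteinAt {x : 𝓞 K} {p : ℕ} (hp : p.Prime)
    (hei : (minpoly ℤ x).IsEisensteinAt (Submodule.span ℤ {(p : ℤ)}))
    (hdeg : (minpoly ℤ x).natDegree = finrank ℚ K) :
    ∃ m : ℤ, ¬ (p : ℤ) ∣ m ∧ (m : 𝓞 K) ∈ conductor ℤ x := by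
  have hp' := Nat.prime_iff_prime_int.mp hp
  have htop := adjoin_eq_top_of_natDegree_minpoly hdeg
  have hxint : IsIntegral ℚ (algebraMap (𝓞 K) K x) := Algebra.IsIntegral.isIntegral _
  let B : PowerBasis ℚ K := PowerBasis.ofAdjoinEqTop hxint htop
  have hB : B.gen = algebraMap (𝓞 K) K x := PowerBasis.ofAdjoinEqTop_gen hxint htop
  have hBint : IsIntegral ℤ B.gen := hB ▸ x.isIntegral_coe
  have hminB : minpoly ℤ B.gen = minpoly ℤ x := by
    rw [hB]; exact minpoly.algebraMap_eq (FaithfulSMul.algebraMap_injective (𝓞 K) K) x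
  have hBi : ∀ i, IsIntegral ℤ (B.basis i) := fun i => by
    rw [B.basis_eq_pow]; exact hBint.pow _
  obtain ⟨d, hd⟩ := IsIntegrallyClosed.isIntegral_iff.mp (Algebra.discr_isIntegral ℚ hBi)
  have hd0 : d ≠ 0 := by
    rintro rfl
    exact Algebra.discr_not_zero_of_basis ℚ B.basis (by rw [← hd, map_zero])
  -- The discriminant d of the power basis satisfies d · 𝓞 K ⊆ ℤ[x]. Its p-part can be cancelled
  -- because the minimal polynomial is Eisenstein at p, so the prime-to-p part m already suffices.
  obtain ⟨m, hdm, hm⟩ := (Int.finiteMultiplicity_iff.mpr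
    ⟨by simpa using hp.ne_one, hd0⟩ : FiniteMultiplicity (p : ℤ) d).exists_eq_pow_mul_and_not_dvd
  refine ⟨m, hm, mem_conductor_iff.mpr fun b => ?_⟩
  have key : ∀ z : K, IsIntegral ℤ z → m • z ∈ Algebra.adjoin ℤ {B.gen} := by
    intro z hz
    refine mem_adjoin_of_smul_prime_pow_smul_of_minpoly_isEisensteinAt (K := ℚ) (p := (p : ℤ))
      (n := multiplicity (p : ℤ) d) hp' hBint (hz.smul m) ?_ (by rw [hminB]; exact hei)
    have := Algebra.discr_mul_isIntegral_mem_adjoin ℚ (B := B) hBint hz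
    rwa [← hd, algebraMap_smul, hdm, mul_smul] at this
  have hb := key _ b.isIntegral_coe
  rw [hB] at hb
  have himg : Algebra.adjoin ℤ {algebraMap (𝓞 K) K x} =
      (Algebra.adjoin ℤ {x}).map (IsScalarTower.toAlgHom ℤ (𝓞 K) K) := by
    rw [AlgHom.map_adjoin]; simp
  rw [himg] at hb
  obtain ⟨y, hy, hyb⟩ := hb
  have : y = m * b := by
    apply FaithfulSMul.algebraMap_injective (𝓞 K) K
    rw [map_mul]
    simpa using hyb
  exact this ▸ hy

/-- The `p`-part of the discriminant of a number field generated by a root `x` of an Eisenstein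
polynomial `f`, read off from the square of `f'(x)`. -/
theorem two_mul_padicValInt_discr_of_isEisensteinAt {x : 𝓞 K} {f : ℤ[X]} {p : ℕ} (hp : p.Prime)
    (hf : f.Monic) (hei : f.IsEisensteinAt (Submodule.span ℤ {(p : ℤ)}))
    (hdeg : f.natDegree = finrank ℚ K) (hx : aeval x f = 0) {y : 𝓞 K} {m : ℤ} {j : ℕ}
    (h : aeval x (derivative f) ^ 2 * y = ((p ^ j * m : ℤ) : 𝓞 K)) (hy : y ∣ (m : 𝓞 K))
    (hpm : ¬ (p : ℤ) ∣ m) : 2 * padicValInt p (discr K) = j * finrank ℚ K := by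
  have := Fact.mk hp
  have hp' := Nat.prime_iff_prime_int.mp hp
  have hirr : Irreducible f := hei.irreducible
    ((Ideal.span_singleton_prime hp'.ne_zero).mpr hp') hf.isPrimitive (hdeg ▸ finrank_pos)
  have hmin := minpoly_eq_of_irreducible hf hirr hx
  have hdeg' : (minpoly ℤ x).natDegree = finrank ℚ K := by rw [hmin, hdeg]
  obtain ⟨k, hpk, hk⟩ := exists_mem_conductor_of_isEisensteinAt hp (hmin ▸ hei) hdeg'
  -- Conductor times different is (f'(x)), and the conductor has norm prime to p, so discr K and
  -- N(f'(x)) have the same p-part.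
  have hcond := congrArg Ideal.absNorm (conductor_mul_differentIdeal ℤ ℚ K x
    (adjoin_eq_top_of_natDegree_minpoly hdeg'))
  rw [map_mul, absNorm_differentIdeal K, Ideal.absNorm_span_singleton, hmin] at hcond
  have hdvd := Ideal.absNorm_dvd_absNorm_of_le ((Ideal.span_singleton_le_iff_mem _).mpr hk)
  rw [Ideal.absNorm_span_singleton, ← eq_intCast (algebraMap ℤ (𝓞 K)),
    Algebra.norm_algebraMap, Int.natAbs_pow] at hdvd
  have hc : ¬ p ∣ Ideal.absNorm (conductor ℤ x) := fun hc =>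
    hpk (Int.natCast_dvd.mpr (hp.dvd_of_dvd_pow (hc.trans hdvd)))
  have hc0 : Ideal.absNorm (conductor ℤ x) ≠ 0 := by intro h0; simp [h0] at hc
  have hval : padicValInt p (discr K) =
      padicValInt p (Algebra.norm ℤ (aeval x (derivative f))) := by
    rw [padicValInt, padicValInt, ← hcond, padicValNat.mul hc0 (by simpa using discr_ne_zero K),
      padicValNat.eq_zero_of_not_dvd hc, zero_add]
  -- In the norm of `h`, the contributions of y and m are prime to p; what remains is 2 v_p(N f'(x))
  -- = j [K : ℚ].
  have hN := congrArg (Algebra.norm ℤ) h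
  have hm0 : m ≠ 0 := by rintro rfl; simp at hpm
  rw [map_mul, map_pow, ← eq_intCast (algebraMap ℤ (𝓞 K)), Algebra.norm_algebraMap,
    RingOfIntegers.rank, mul_pow, ← pow_mul] at hN
  have hr : p ^ (j * finrank ℚ K) ≠ 0 := pow_ne_zero _ hp.ne_zero
  have hR0 : ((p : ℤ) ^ (j * finrank ℚ K) * m ^ finrank ℚ K) ≠ 0 :=
    mul_ne_zero (mod_cast hr) (pow_ne_zero _ hm0)
  have hL0 := hN ▸ hR0
  have hv := congrArg (padicValInt p) hN
  rw [padicValInt.mul (left_ne_zero_of_mul hL0) (right_ne_zero_of_mul hL0),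
    padicValInt.mul (mod_cast hr) (pow_ne_zero _ hm0),
    padicValInt.eq_zero_of_not_dvd (not_dvd_norm_of_dvd hp hy hpm),
    padicValInt.eq_zero_of_not_dvd (fun h' => hpm (hp'.dvd_of_dvd_pow h'))] at hv
  rw [hval]
  have h2 : padicValInt p ((Algebra.norm ℤ) (aeval x (derivative f)) ^ 2) =
      2 * padicValInt p (Algebra.norm ℤ (aeval x (derivative f))) := by
    rw [padicValInt, Int.natAbs_pow, padicValNat.pow, padicValInt]
  rw [h2, padicValInt, padicValInt, Int.natAbs_pow, Int.natAbs_natCast, padicValNat.prime_pow] at hv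
  simpa [padicValInt] using hv

end DiscriminantTools
-- Fields generated by square roots; Kummer theory for exponent 2
section SqrtField
open Module Polynomial

/-- The extension of `ℚ` inside `Ω` generated by the square roots of the integers in `S`. -/
noncomputable def sqrtField (Ω : Type*) [Field Ω] [Algebra ℚ Ω] (S : Finset ℤ) :
    IntermediateField ℚ Ω :=
  IntermediateField.adjoin ℚ {z : Ω | ∃ b ∈ S, z ^ 2 = (b : Ω)}

/-- The integer `b` is a square in the field `E`. -/
def HasSqrt {Ω : Type*} [Field Ω] [Algebra ℚ Ω] (E : IntermediateField ℚ Ω) (b : ℤ) : Prop :=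
  ∃ z ∈ E, z ^ 2 = (b : Ω)

variable {Ω : Type*} [Field Ω] [Algebra ℚ Ω]

theorem HasSqrt.mem {E : IntermediateField ℚ Ω} {b : ℤ} (h : HasSqrt E b) {z : Ω}
    (hz : z ^ 2 = (b : Ω)) : z ∈ E := by
  obtain ⟨w, hw, hwb⟩ := h
  rcases sq_eq_sq_iff_eq_or_eq_neg.mp (hz.trans hwb.symm) with rfl | rfl
  · exact hw
  · exact neg_mem hw

theorem HasSqrt.mono {E F : IntermediateField ℚ Ω} (hEF : E ≤ F) {b : ℤ} (h : HasSqrt E b) :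
    HasSqrt F b := by
  obtain ⟨w, hw, hwb⟩ := h
  exact ⟨w, hEF hw, hwb⟩

theorem HasSqrt.mul {E : IntermediateField ℚ Ω} {b c : ℤ} (hb : HasSqrt E b) (hc : HasSqrt E c) :
    HasSqrt E (b * c) := by
  obtain ⟨w, hw, hwb⟩ := hb
  obtain ⟨v, hv, hvc⟩ := hc
  exact ⟨w * v, mul_mem hw hv, by rw [mul_pow, hwb, hvc]; push_cast; rfl⟩

theorem hasSqrt_of_isSquare (E : IntermediateField ℚ Ω) {b : ℤ} (h : IsSquare b) :
    HasSqrt E b := by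
  obtain ⟨k, rfl⟩ := h
  exact ⟨(k : Ω), intCast_mem E _, by push_cast; rw [sq]⟩

theorem HasSqrt.of_mul_isSquare {E : IntermediateField ℚ Ω} {b c : ℤ} (hb : HasSqrt E b)
    (hb0 : b ≠ 0) (h : IsSquare (b * c)) : HasSqrt E c := by
  obtain ⟨k, hk⟩ := h
  obtain ⟨w, hw, hwb⟩ := hb
  have : CharZero Ω := algebraRat.charZero Ω
  have hb' : (b : Ω) ≠ 0 := by exact_mod_cast hb0
  have hw0 : w ≠ 0 := by rintro rfl; exact hb' (by rw [← hwb]; simp)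
  refine ⟨(k : Ω) / w, div_mem (intCast_mem E _) hw, ?_⟩
  rw [div_pow, hwb, div_eq_iff hb']
  exact_mod_cast (by rw [sq, ← hk, mul_comm] : k ^ 2 = c * b)

theorem hasSqrt_bot_iff {b : ℤ} : HasSqrt (⊥ : IntermediateField ℚ Ω) b ↔ IsSquare b := by
  refine ⟨?_, hasSqrt_of_isSquare _⟩
  rintro ⟨z, hz, hzb⟩
  obtain ⟨q, rfl⟩ := IntermediateField.mem_bot.mp hz
  have hq : q ^ 2 = b := (algebraMap ℚ Ω).injective (by rw [map_pow, hzb, map_intCast])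
  exact Rat.isSquare_intCast_iff.mp ⟨q, by rw [← hq, sq]⟩

theorem sqrtField_le_iff [IsAlgClosed Ω] {S : Finset ℤ} {E : IntermediateField ℚ Ω} :
    sqrtField Ω S ≤ E ↔ ∀ b ∈ S, HasSqrt E b := by
  rw [sqrtField, IntermediateField.adjoin_le_iff]
  constructor
  · intro h b hb
    obtain ⟨w, hw⟩ := IsAlgClosed.exists_pow_nat_eq (b : Ω) (n := 2) (by norm_num)
    exact ⟨w, h ⟨b, hb, hw⟩, hw⟩
  · rintro h z ⟨b, hb, hz⟩
    exact (h b hb).mem hz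

theorem hasSqrt_sqrtField [IsAlgClosed Ω] {S : Finset ℤ} {b : ℤ} (hb : b ∈ S) :
    HasSqrt (sqrtField Ω S) b :=
  sqrtField_le_iff.mp le_rfl b hb

theorem sqrtField_insert [IsAlgClosed Ω] (c : ℤ) (S : Finset ℤ) :
    sqrtField Ω (insert c S) = sqrtField Ω S ⊔ sqrtField Ω {c} := by
  apply le_antisymm
  · rw [sqrtField_le_iff]
    intro b hb
    rcases Finset.mem_insert.mp hb with rfl | hb
    · exact (hasSqrt_sqrtField (Finset.mem_singleton_self b)).mono le_sup_right
    · exact (hasSqrt_sqrtField hb).mono le_sup_left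
  · refine sup_le ?_ ?_ <;> rw [sqrtField_le_iff] <;> intro b hb <;> apply hasSqrt_sqrtField
    · exact Finset.mem_insert_of_mem hb
    · rw [Finset.mem_singleton.mp hb]; exact Finset.mem_insert_self c S

theorem sqrtField_empty : sqrtField Ω ∅ = ⊥ := by
  simp [sqrtField]

theorem sqrtField_singleton_eq_adjoin {c : ℤ} {r : Ω} (hr : r ^ 2 = (c : Ω)) :
    sqrtField Ω {c} = IntermediateField.adjoin ℚ {r} := by
  apply le_antisymm <;> rw [sqrtField, IntermediateField.adjoin_le_iff]
  · rintro z ⟨b, hb, hz⟩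
    rw [Finset.mem_singleton.mp hb] at hz
    exact HasSqrt.mem ⟨r, IntermediateField.mem_adjoin_simple_self ℚ r, hr⟩ hz
  · rintro z rfl
    exact IntermediateField.subset_adjoin _ _ ⟨c, Finset.mem_singleton_self c, hr⟩

theorem sup_sqrtField_eq_restrictScalars (E : IntermediateField ℚ Ω) {c : ℤ} {r : Ω}
    (hr : r ^ 2 = (c : Ω)) :
    E ⊔ sqrtField Ω {c} = (IntermediateField.adjoin E {r}).restrictScalars ℚ := by
  rw [sqrtField_singleton_eq_adjoin hr]
  exact (IntermediateField.restrictScalars_adjoin_eq_sup ℚ E {r}).symm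

theorem isIntegral_intermediateField_of_sq_eq_intCast (E : IntermediateField ℚ Ω) {c : ℤ} {r : Ω}
    (hr : r ^ 2 = (c : Ω)) : IsIntegral E r := by
  refine IsIntegral.of_pow (n := 2) (by norm_num) ?_
  rw [hr]
  exact_mod_cast isIntegral_algebraMap (R := E) (A := Ω) (x := (c : E))

theorem exists_eq_add_mul_of_mem_sup_sqrtField {E : IntermediateField ℚ Ω} {c : ℤ} {r : Ω}
    (hr : r ^ 2 = (c : Ω)) {z : Ω} (hz : z ∈ E ⊔ sqrtField Ω {c}) :
    ∃ α ∈ E, ∃ β ∈ E, z = α + β * r := by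
  rw [sup_sqrtField_eq_restrictScalars E hr, IntermediateField.mem_restrictScalars,
    ← IntermediateField.mem_toSubalgebra,
    IntermediateField.adjoin_simple_toSubalgebra_of_isAlgebraic
      (isIntegral_intermediateField_of_sq_eq_intCast E hr).isAlgebraic] at hz
  induction hz using Algebra.adjoin_induction with
  | mem x hx => exact ⟨0, zero_mem _, 1, one_mem _, by rw [Set.mem_singleton_iff.mp hx]; ring⟩
  | algebraMap x => exact ⟨x, x.2, 0, zero_mem _, by rw [zero_mul, add_zero]; rfl⟩
  | add x y _ _ hx hy =>
    obtain ⟨α, hα, β, hβ, rfl⟩ := hx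
    obtain ⟨γ, hγ, δ, hδ, rfl⟩ := hy
    exact ⟨α + γ, add_mem hα hγ, β + δ, add_mem hβ hδ, by ring⟩
  | mul x y _ _ hx hy =>
    obtain ⟨α, hα, β, hβ, rfl⟩ := hx
    obtain ⟨γ, hγ, δ, hδ, rfl⟩ := hy
    refine ⟨α * γ + β * δ * (c : Ω),
      add_mem (mul_mem hα hγ) (mul_mem (mul_mem hβ hδ) (intCast_mem E _)), α * δ + β * γ,
      add_mem (mul_mem hα hδ) (mul_mem hβ hγ), ?_⟩
    rw [← hr]; ring

/-- Write √d = α + β√c with α, β in E. Squaring puts 2αβ√c in E. If αβ ≠ 0, then √c and hence √d lie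
in E; if β = 0, then d = α²; if α = 0, then dc = (βc)². -/
theorem hasSqrt_or_hasSqrt_mul_of_hasSqrt_sup [IsAlgClosed Ω] {E : IntermediateField ℚ Ω}
    {c d : ℤ} (h : HasSqrt (E ⊔ sqrtField Ω {c}) d) : HasSqrt E d ∨ HasSqrt E (d * c) := by
  have : CharZero Ω := algebraRat.charZero Ω
  obtain ⟨r, hr⟩ := IsAlgClosed.exists_pow_nat_eq (c : Ω) (n := 2) (by norm_num)
  obtain ⟨z, hz, hzd⟩ := h
  obtain ⟨α, hα, β, hβ, rfl⟩ := exists_eq_add_mul_of_mem_sup_sqrtField hr hz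
  rcases eq_or_ne α 0 with rfl | hα0
  · right
    refine ⟨β * (c : Ω), mul_mem hβ (intCast_mem E _), ?_⟩
    push_cast
    rw [← hzd, ← hr]; ring
  left
  rcases eq_or_ne β 0 with rfl | hβ0
  · exact ⟨α, hα, by rw [← hzd]; ring⟩
  have hrE : r = ((d : Ω) - α ^ 2 - β ^ 2 * (c : Ω)) / (2 * α * β) := by
    rw [eq_div_iff (by simp [hα0, hβ0]), ← hzd, ← hr]; ring
  refine ⟨α + β * r, add_mem hα (mul_mem hβ ?_), hzd⟩
  rw [hrE]
  exact div_mem (sub_mem (sub_mem (intCast_mem E _) (pow_mem hα 2))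
    (mul_mem (pow_mem hβ 2) (intCast_mem E _)))
    (mul_mem (mul_mem (ofNat_mem E 2) hα) hβ)

theorem finrank_sup_sqrtField [IsAlgClosed Ω] {E : IntermediateField ℚ Ω} {c : ℤ}
    (h : ¬ HasSqrt E c) : finrank ℚ ↥(E ⊔ sqrtField Ω {c}) = finrank ℚ E * 2 := by
  obtain ⟨r, hr⟩ := IsAlgClosed.exists_pow_nat_eq (c : Ω) (n := 2) (by norm_num)
  have hrE : r ∉ E := fun hrE => h ⟨r, hrE, hr⟩
  have hint := isIntegral_intermediateField_of_sq_eq_intCast E hr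
  have hdeg : (minpoly E r).natDegree = 2 := by
    apply le_antisymm
    · have hm : (X ^ 2 - C (c : E) : E[X]).Monic := monic_X_pow_sub_C _ (by norm_num)
      have h0 : aeval r (X ^ 2 - C (c : E) : E[X]) = 0 := by
        simp [hr]
      calc (minpoly E r).natDegree ≤ (X ^ 2 - C (c : E) : E[X]).natDegree :=
            natDegree_le_natDegree (minpoly.min E r hm h0)
        _ = 2 := natDegree_X_pow_sub_C
    · rw [minpoly.two_le_natDegree_iff hint]
      rintro ⟨x, rfl⟩
      exact hrE x.2
  rw [sup_sqrtField_eq_restrictScalars E hr, ← hdeg,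
    ← IntermediateField.adjoin.finrank hint]
  exact (Module.finrank_mul_finrank ℚ E (IntermediateField.adjoin E {r})).symm

variable {ι : Type*} [DecidableEq ι]

/-- Generators are removed one at a time, each at the cost of at most a factor a_i; over ℚ itself
only integer squares remain. -/
theorem exists_isSquare_mul_prod_of_hasSqrt [IsAlgClosed Ω] (a : ι → ℤ) (s : Finset ι) {d : ℤ}
    (h : HasSqrt (sqrtField Ω (s.image a)) d) : ∃ J ⊆ s, IsSquare (d * ∏ j ∈ J, a j) := by
  induction s using Finset.induction_on generalizing d with
  | empty =>
    rw [Finset.image_empty, sqrtField_empty, hasSqrt_bot_iff] at h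
    exact ⟨∅, subset_rfl, by simpa using h⟩
  | insert i s hi ih =>
    rw [Finset.image_insert, sqrtField_insert] at h
    rcases hasSqrt_or_hasSqrt_mul_of_hasSqrt_sup h with h | h
    · obtain ⟨J, hJ, hsq⟩ := ih h
      exact ⟨J, hJ.trans (Finset.subset_insert i s), hsq⟩
    · obtain ⟨J, hJ, hsq⟩ := ih h
      refine ⟨insert i J, Finset.insert_subset_insert i hJ, ?_⟩
      rwa [Finset.prod_insert (fun hiJ => hi (hJ hiJ)), ← mul_assoc]

instance sqrtField.finiteDimensional (S : Finset ℤ) : FiniteDimensional ℚ (sqrtField Ω S) := by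
  have hfin : {z : Ω | ∃ b ∈ S, z ^ 2 = (b : Ω)}.Finite := by
    have : {z : Ω | ∃ b ∈ S, z ^ 2 = (b : Ω)} ⊆
        ⋃ b ∈ S, {z : Ω | z ∈ (X ^ 2 - C (b : Ω)).roots} := by
      rintro z ⟨b, hb, hz⟩
      simp only [Set.mem_iUnion]
      refine ⟨b, hb, ?_⟩
      exact (mem_roots (X_pow_sub_C_ne_zero (by norm_num) _)).mpr (by simp [hz])
    refine Set.Finite.subset (Set.Finite.biUnion S.finite_toSet fun b _ => ?_) this
    exact Multiset.finite_toSet _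
  have := hfin.to_subtype
  refine IntermediateField.finiteDimensional_adjoin ?_
  rintro z ⟨b, -, hz⟩
  refine IsIntegral.of_pow (n := 2) (by norm_num) ?_
  rw [hz]
  rw [← map_intCast (algebraMap ℚ Ω)]
  exact isIntegral_algebraMap

instance sqrtField.numberField (S : Finset ℤ) : NumberField (sqrtField Ω S) where
  to_charZero := algebraRat.charZero _
  to_finiteDimensional := by
    -- The ℚ-algebra structure inherited from Ω and the canonical one on a field of characteristic
    -- zero need not agree by definition; they are equal by uniqueness. The same issue recurs below.
    convert! sqrtField.finiteDimensional (Ω := Ω) S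
    exact Subsingleton.elim _ _

end SqrtField
-- Local discriminants of quadratic fields, and of the biquadratic field at 2
section QuadraticDiscriminants
open NumberField Module Polynomial

theorem monic_quadratic (u v : ℤ) : (X ^ 2 + C u * X + C v : ℤ[X]).Monic := by
  monicity!

theorem natDegree_monic_quadratic (u v : ℤ) : (X ^ 2 + C u * X + C v : ℤ[X]).natDegree = 2 := by
  compute_degree!

theorem irreducible_quadratic {u v : ℤ} (h : ¬ IsSquare (u ^ 2 - 4 * v)) :
    Irreducible (X ^ 2 + C u * X + C v : ℤ[X]) := by
  rw [(monic_quadratic u v).irreducible_iff_roots_eq_zero_of_degree_le_three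
    (natDegree_monic_quadratic u v).ge (by rw [natDegree_monic_quadratic]; norm_num),
    Multiset.eq_zero_iff_forall_notMem]
  intro n hn
  have h0 := (mem_roots'.mp hn).2
  simp only [IsRoot, eval_add, eval_mul, eval_pow, eval_X, eval_C] at h0
  exact h ⟨2 * n + u, by linear_combination (-4) * h0⟩

theorem isEisensteinAt_quadratic {p : ℕ} (hp : p.Prime) {u v : ℤ} (hu : (p : ℤ) ∣ u)
    (hv : (p : ℤ) ∣ v) (hv' : ¬ (p : ℤ) ^ 2 ∣ v) :
    (X ^ 2 + C u * X + C v : ℤ[X]).IsEisensteinAt (Submodule.span ℤ {(p : ℤ)}) := by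
  have hp' := Nat.prime_iff_prime_int.mp hp
  refine (monic_quadratic u v).isEisensteinAt_of_mem_of_notMem
    ((Ideal.span_singleton_prime hp'.ne_zero).mpr hp').ne_top ?_ ?_
  · intro n hn
    rw [natDegree_monic_quadratic] at hn
    rw [Ideal.submodule_span_eq, Ideal.mem_span_singleton]
    interval_cases n <;> simpa [coeff_X, coeff_C, -eq_intCast]
  · rw [Ideal.submodule_span_eq, Ideal.span_singleton_pow, Ideal.mem_span_singleton]
    simpa [coeff_X, coeff_C, -eq_intCast]

theorem isEisensteinAt_quartic {p : ℕ} (hp : p.Prime) {a₃ a₂ a₁ a₀ : ℤ} (h₃ : (p : ℤ) ∣ a₃)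
    (h₂ : (p : ℤ) ∣ a₂) (h₁ : (p : ℤ) ∣ a₁) (h₀ : (p : ℤ) ∣ a₀) (h₀' : ¬ (p : ℤ) ^ 2 ∣ a₀) :
    (X ^ 4 + C a₃ * X ^ 3 + C a₂ * X ^ 2 + C a₁ * X + C a₀ : ℤ[X]).IsEisensteinAt
      (Submodule.span ℤ {(p : ℤ)}) := by
  have hp' := Nat.prime_iff_prime_int.mp hp
  have hdeg : (X ^ 4 + C a₃ * X ^ 3 + C a₂ * X ^ 2 + C a₁ * X + C a₀ : ℤ[X]).natDegree = 4 := by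
    compute_degree!
  have hm : (X ^ 4 + C a₃ * X ^ 3 + C a₂ * X ^ 2 + C a₁ * X + C a₀ : ℤ[X]).Monic := by monicity!
  refine hm.isEisensteinAt_of_mem_of_notMem
    ((Ideal.span_singleton_prime hp'.ne_zero).mpr hp').ne_top ?_ ?_
  · intro n hn
    rw [hdeg] at hn
    rw [Ideal.submodule_span_eq, Ideal.mem_span_singleton]
    interval_cases n <;> simpa [coeff_X, coeff_C, coeff_X_pow, -eq_intCast]
  · rw [Ideal.submodule_span_eq, Ideal.span_singleton_pow, Ideal.mem_span_singleton]
    simpa [coeff_X, coeff_C, coeff_X_pow, -eq_intCast]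

theorem aeval_quadratic {A : Type*} [CommRing A] (u v : ℤ) (x : A) :
    aeval x (X ^ 2 + C u * X + C v : ℤ[X]) = x ^ 2 + u * x + v := by
  simp

theorem aeval_derivative_quadratic {A : Type*} [CommRing A] (u v : ℤ) (x : A) :
    aeval x (derivative (X ^ 2 + C u * X + C v : ℤ[X])) = 2 * x + u := by
  simp [-eq_intCast]

theorem aeval_quartic {A : Type*} [CommRing A] (a₃ a₂ a₁ a₀ : ℤ) (x : A) :
    aeval x (X ^ 4 + C a₃ * X ^ 3 + C a₂ * X ^ 2 + C a₁ * X + C a₀ : ℤ[X]) =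
      x ^ 4 + a₃ * x ^ 3 + a₂ * x ^ 2 + a₁ * x + a₀ := by
  simp

theorem aeval_derivative_quartic {A : Type*} [CommRing A] (a₃ a₂ a₁ a₀ : ℤ) (x : A) :
    aeval x (derivative (X ^ 4 + C a₃ * X ^ 3 + C a₂ * X ^ 2 + C a₁ * X + C a₀ : ℤ[X])) =
      4 * x ^ 3 + 3 * a₃ * x ^ 2 + 2 * a₂ * x + a₁ := by
  simp [-eq_intCast]
  ring

theorem exists_algebraMap_ringOfIntegers_eq {K : Type*} [Field K] {z : K} (hz : IsIntegral ℤ z) :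
    ∃ x : 𝓞 K, algebraMap (𝓞 K) K x = z :=
  ⟨⟨z, hz⟩, rfl⟩

theorem exists_ringOfIntegers_sq_eq {K : Type*} [Field K] {r : K} {b : ℤ} (hr : r ^ 2 = b) :
    ∃ x : 𝓞 K, algebraMap (𝓞 K) K x = r ∧ x ^ 2 = b := by
  obtain ⟨x, rfl⟩ : ∃ x : 𝓞 K, algebraMap (𝓞 K) K x = r := by
    refine exists_algebraMap_ringOfIntegers_eq (IsIntegral.of_pow (n := 2) (by norm_num) ?_)
    rw [hr]; exact isIntegral_algebraMap (R := ℤ) (A := K)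
  refine ⟨x, rfl, FaithfulSMul.algebraMap_injective (𝓞 K) K ?_⟩
  rw [map_pow, hr, map_intCast]

variable {K : Type*} [Field K] [NumberField K]

/-- For f = X² - b the derivative 2x divides 2x · x = 2b. -/
theorem not_dvd_discr_of_not_dvd_two_mul (hK : finrank ℚ K = 2) {b : ℤ} (hb : ¬ IsSquare b) {r : K}
    (hr : r ^ 2 = b) {p : ℕ} (hp : p.Prime) (h : ¬ (p : ℤ) ∣ 2 * b) : ¬ (p : ℤ) ∣ discr K := by
  obtain ⟨x, -, hx⟩ := exists_ringOfIntegers_sq_eq hr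
  refine not_dvd_discr_of_dvd_aeval_derivative (x := x) (monic_quadratic 0 (-b))
    (irreducible_quadratic ?_) (by rw [natDegree_monic_quadratic, hK]) (by rw [aeval_quadratic, hx]; push_cast; ring) hp
    (m := 2 * b) ⟨x, ?_⟩ h
  · rintro ⟨k, hk⟩
    obtain ⟨l, rfl⟩ : (2 : ℤ) ∣ k := by
      refine Int.prime_two.dvd_of_dvd_pow (n := 2) ⟨2 * b, ?_⟩
      linear_combination -hk
    exact hb ⟨l, by linarith⟩
  · rw [aeval_derivative_quadratic]
    push_cast
    rw [← hx]; ring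

/-- With b = 4k + 1, the integer x = (1 + √b)/2 is a root of X² - X - k, and f'(x) = 2x - 1 has the
odd square b. -/
theorem not_two_dvd_discr_of_emod_four_eq_one (hK : finrank ℚ K = 2) {b : ℤ} (hb : ¬ IsSquare b)
    {r : K} (hr : r ^ 2 = b) (h : b % 4 = 1) : ¬ ((2 : ℕ) : ℤ) ∣ discr K := by
  obtain ⟨k, rfl⟩ : ∃ k, b = 4 * k + 1 := ⟨b / 4, by omega⟩
  have hroot : ((1 + r) / 2) ^ 2 + ((-1 : ℤ) : K) * ((1 + r) / 2) + ((-k : ℤ) : K) = 0 := by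
    push_cast at hr ⊢
    linear_combination hr / 4
  obtain ⟨x, hx⟩ : ∃ x : 𝓞 K, algebraMap (𝓞 K) K x = (1 + r) / 2 := by
    refine exists_algebraMap_ringOfIntegers_eq ⟨_, monic_quadratic (-1) (-k), ?_⟩
    rw [← aeval_def, aeval_quadratic]; exact hroot
  rw [← hx] at hroot
  have hx0 : x ^ 2 + ((-1 : ℤ) : 𝓞 K) * x + ((-k : ℤ) : 𝓞 K) = 0 := by
    apply FaithfulSMul.algebraMap_injective (𝓞 K) K
    simpa using hroot
  refine not_dvd_discr_of_dvd_aeval_derivative (x := x) (monic_quadratic (-1) (-k))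
    (irreducible_quadratic ?_) (by rw [natDegree_monic_quadratic, hK]) (by rw [aeval_quadratic]; exact hx0)
    Nat.prime_two (m := 4 * k + 1) ⟨2 * x - 1, ?_⟩ (by omega)
  · convert hb using 2; ring
  · rw [aeval_derivative_quadratic]
    push_cast at hx0 ⊢
    linear_combination (-4) * hx0

/-- The shift √b + 1 has minimal polynomial X² - 2X + (1 - b), Eisenstein at 2 because 1 - b ≡ 2 mod
4, and f'(x)² = 2² b. -/
theorem padicValInt_two_discr_of_emod_four_eq_three (hK : finrank ℚ K = 2) {b : ℤ} {r : K}
    (hr : r ^ 2 = b) (h : b % 4 = 3) : padicValInt 2 (discr K) = 2 := by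
  obtain ⟨x, -, hx⟩ := exists_ringOfIntegers_sq_eq hr
  have := two_mul_padicValInt_discr_of_isEisensteinAt (x := x + 1) Nat.prime_two
    (monic_quadratic (-2) (1 - b))
    (isEisensteinAt_quadratic Nat.prime_two (by norm_num) (by push_cast; omega)
      (by push_cast; omega))
    (by rw [natDegree_monic_quadratic, hK]) (by rw [aeval_quadratic]; push_cast; linear_combination hx)
    (y := 1) (m := b) (j := 2) ?_ (one_dvd _) (by push_cast; omega)
  · rw [hK] at this; omega
  · rw [aeval_derivative_quadratic]
    push_cast
    linear_combination 4 * hx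

/-- Here X² - b is itself Eisenstein at 2, and f'(x)² = 4b = 2³ w. -/
theorem padicValInt_two_discr_of_emod_four_eq_two (hK : finrank ℚ K = 2) {b : ℤ} {r : K}
    (hr : r ^ 2 = b) (h : b % 4 = 2) : padicValInt 2 (discr K) = 3 := by
  obtain ⟨w, rfl⟩ : ∃ w, b = 2 * w := ⟨b / 2, by omega⟩
  obtain ⟨x, -, hx⟩ := exists_ringOfIntegers_sq_eq hr
  have := two_mul_padicValInt_discr_of_isEisensteinAt (x := x) Nat.prime_two
    (monic_quadratic 0 (-(2 * w)))
    (isEisensteinAt_quadratic Nat.prime_two (by norm_num) (by push_cast; omega)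
      (by push_cast; omega))
    (by rw [natDegree_monic_quadratic, hK]) (by rw [aeval_quadratic, hx]; push_cast; ring)
    (y := 1) (m := w) (j := 3) ?_ (one_dvd _) (by push_cast; omega)
  · rw [hK] at this; omega
  · rw [aeval_derivative_quadratic]
    push_cast at hx ⊢
    linear_combination 4 * hx

/-- A biquadratic field `ℚ(√u, √(2w))` with `u ≡ 3 mod 4` and `w` odd is totally ramified at `2`,
with discriminant exponent `8`. -/
theorem padicValInt_two_discr_biquadratic (hK : finrank ℚ K = 4) {u w : ℤ} {r s : K}
    (hr : r ^ 2 = u) (hs : s ^ 2 = ((2 * w : ℤ) : K)) (hu : u % 4 = 3) (hw : w % 2 = 1) :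
    padicValInt 2 (discr K) = 8 := by
  obtain ⟨t, rfl⟩ : ∃ t, u = 4 * t - 1 := ⟨(u + 1) / 4, by omega⟩
  obtain ⟨r, rfl, hr'⟩ := exists_ringOfIntegers_sq_eq hr
  -- The element β = s(1 + r)/2 is integral, as β² = w(2t + r). Its shift β - 1 is the Eisenstein
  -- generator.
  have hβ : (s * (1 + algebraMap (𝓞 K) K r) / 2) ^ 2 =
      algebraMap (𝓞 K) K ((w : 𝓞 K) * ((2 * t : ℤ) + r)) := by
    simp only [map_mul, map_add, map_intCast]
    push_cast at hr hs ⊢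
    linear_combination (1 + algebraMap (𝓞 K) K r) ^ 2 / 4 * hs + (w : K) / 2 * hr
  obtain ⟨β, hβ'⟩ : ∃ β : 𝓞 K, algebraMap (𝓞 K) K β = s * (1 + algebraMap (𝓞 K) K r) / 2 := by
    refine exists_algebraMap_ringOfIntegers_eq (IsIntegral.of_pow (n := 2) (by norm_num) ?_)
    rw [hβ]; exact RingOfIntegers.isIntegral_coe _
  have hβ2 : β ^ 2 = (w : 𝓞 K) * ((2 * t : ℤ) + r) := by
    apply FaithfulSMul.algebraMap_injective (𝓞 K) K
    rw [map_pow, hβ', hβ]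
  push_cast at hβ2 hr'
  have hβ4 : (β ^ 2 - 2 * w * t) ^ 2 = w ^ 2 * (4 * t - 1) := by
    rw [hβ2]; linear_combination (w : 𝓞 K) ^ 2 * hr'
  obtain ⟨v, rfl⟩ : ∃ v, w = 2 * v + 1 := ⟨w / 2, by omega⟩
  set w : ℤ := 2 * v + 1 with hwdef
  have hw2 : w ^ 2 = 4 * (v ^ 2 + v) + 1 := by rw [hwdef]; ring
  -- This is the constant term of ((X + 1)² - 2wt)² - w²(4t - 1), the quartic satisfied by β - 1; it
  -- is 2 mod 4 because w² ≡ 1 mod 4.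
  have h0 : 1 - 4 * w * t + w ^ 2 * (4 * t ^ 2 - (4 * t - 1)) =
      4 * (-(w * t) + (4 * (v ^ 2 + v) + 1) * (t ^ 2 - t) + (v ^ 2 + v)) + 2 := by
    rw [hw2]; ring
  have := two_mul_padicValInt_discr_of_isEisensteinAt (x := β - 1) Nat.prime_two
    (f := X ^ 4 + C 4 * X ^ 3 + C (6 - 4 * w * t) * X ^ 2 + C (4 - 8 * w * t) * X +
      C (1 - 4 * w * t + w ^ 2 * (4 * t ^ 2 - (4 * t - 1))))
    (by monicity!)
    (isEisensteinAt_quartic Nat.prime_two (by norm_num) ⟨3 - 2 * w * t, by push_cast; ring⟩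
      ⟨2 - 4 * w * t, by push_cast; ring⟩ (by rw [h0]; push_cast; omega)
      (by rw [h0]; push_cast; omega))
    (by rw [hK]; compute_degree!) ?_
    -- Since f'(β - 1) = 4β(β² - 2wt) = 4βwr, its square is 2⁴ w³ r² (2t + r). The conjugate factor
    -- y = 2t - r turns this into 2⁴ times an odd integer, so j = 4 and the exponent is 4 · 4 / 2 =
    -- 8.
    (y := 2 * (t : 𝓞 K) - r) (m := w ^ 3 * (4 * t - 1) * (4 * t ^ 2 - (4 * t - 1))) (j := 4) ?_ (Dvd.intro ((w : 𝓞 K) ^ 3 * (4 * (t : 𝓞 K) - 1) * (2 * (t : 𝓞 K) + r)) ?_) ?_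
  · rw [hK] at this; omega
  · rw [aeval_quartic]
    push_cast
    linear_combination hβ4
  · rw [aeval_derivative_quartic]
    push_cast
    have h1 : 4 * (β - 1) ^ 3 + 3 * 4 * (β - 1) ^ 2 + 2 * (6 - 4 * (w : 𝓞 K) * t) * (β - 1) +
        (4 - 8 * w * t) = 4 * β * (w * r) := by
      linear_combination 4 * β * hβ2
    rw [h1]
    linear_combination (16 * (w : 𝓞 K) ^ 2 * r ^ 2 * (2 * t - r)) * hβ2 +
      (16 * (w : 𝓞 K) ^ 3 * (4 * t ^ 2 - r ^ 2 - (4 * t - 1))) * hr'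
  · push_cast
    linear_combination (-(w : 𝓞 K) ^ 3 * (4 * t - 1)) * hr'
  · intro h
    have h2 : Odd (w ^ 3 * (4 * t - 1) * (4 * t ^ 2 - (4 * t - 1))) := by
      refine (Odd.mul (Odd.pow (Int.odd_iff.mpr hw)) ?_).mul ?_
      · exact ⟨2 * t - 1, by ring⟩
      · exact ⟨2 * t ^ 2 - 2 * t, by ring⟩
    exact (Int.not_even_iff_odd.mpr h2) (even_iff_two_dvd.mpr (by exact_mod_cast h))

end QuadraticDiscriminants
-- Real and complex places, and the sign of the discriminant
section DiscriminantSign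
open NumberField Module

theorem isTotallyComplex_of_sq_eq_neg {K : Type*} [Field K] [NumberField K] {r : K} {b : ℤ}
    (hr : r ^ 2 = b) (hb : b < 0) : IsTotallyComplex K := by
  refine ⟨fun v => ?_⟩
  rw [← InfinitePlace.not_isReal_iff_isComplex]
  intro hv
  have h := congrArg (InfinitePlace.embedding_of_isReal hv) hr
  rw [map_pow, map_intCast] at h
  have : ((b : ℤ) : ℝ) < 0 := by exact_mod_cast hb
  nlinarith [sq_nonneg (InfinitePlace.embedding_of_isReal hv r)]

theorem Complex.conj_eq_self_of_sq_eq_pos {z : ℂ} {b : ℤ} (hz : z ^ 2 = b) (hb : 0 < b) :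
    starRingEnd ℂ z = z := by
  have hre := congrArg Complex.re hz
  have him := congrArg Complex.im hz
  rw [sq] at hre him
  simp only [Complex.mul_re, Complex.mul_im, Complex.intCast_re, Complex.intCast_im] at hre him
  have hb' : (0 : ℝ) < b := by exact_mod_cast hb
  rw [Complex.conj_eq_iff_im]
  by_contra h
  have : z.re = 0 := by
    have : z.re * z.im = 0 := by linarith
    exact (mul_eq_zero.mp this).resolve_right h
  rw [this] at hre
  nlinarith [sq_nonneg z.im]

variable {Ω : Type*} [Field Ω] [Algebra ℚ Ω]

/-- Every complex embedding sends each generator to a number with positive square, hence to a real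
number. -/
theorem isTotallyReal_sqrtField {S : Finset ℤ} (hS : ∀ b ∈ S, 0 < b) :
    IsTotallyReal (sqrtField Ω S) := by
  refine ⟨fun v => ?_⟩
  rw [← InfinitePlace.mk_embedding v, InfinitePlace.isReal_mk_iff, ComplexEmbedding.isReal_iff]
  set φ := v.embedding
  ext ⟨x, hx⟩
  rw [ComplexEmbedding.conjugate_coe_eq]
  change x ∈ IntermediateField.adjoin ℚ _ at hx
  induction hx using IntermediateField.adjoin_induction with
  | mem x h =>
    obtain ⟨b, hb, hxb⟩ := h
    refine Complex.conj_eq_self_of_sq_eq_pos (b := b) ?_ (hS b hb)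
    rw [← map_pow, ← map_intCast φ]
    congr 1
    exact Subtype.ext (by simpa using hxb)
  | algebraMap q =>
    have : (⟨algebraMap ℚ Ω q, IntermediateField.algebraMap_mem _ q⟩ : sqrtField Ω S) = (q : ℚ) :=
      Subtype.ext (by simp)
    rw [this, map_ratCast, map_ratCast]
  | add x y hx hy h₁ h₂ =>
    have : (⟨x + y, add_mem hx hy⟩ : sqrtField Ω S) = ⟨x, hx⟩ + ⟨y, hy⟩ := rfl
    rw [this, map_add, map_add, h₁, h₂]
  | inv x hx h =>
    have : (⟨x⁻¹, inv_mem hx⟩ : sqrtField Ω S) = ⟨x, hx⟩⁻¹ := rfl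
    rw [this, map_inv₀, map_inv₀, h]
  | mul x y hx hy h₁ h₂ =>
    have : (⟨x * y, mul_mem hx hy⟩ : sqrtField Ω S) = ⟨x, hx⟩ * ⟨y, hy⟩ := rfl
    rw [this, map_mul, map_mul, h₁, h₂]

theorem discr_sqrtField_pos {S : Finset ℤ} (hS : ∀ b ∈ S, 0 < b) :
    0 < discr (sqrtField Ω S) := by
  have := isTotallyReal_sqrtField (Ω := Ω) hS
  rw [← Int.sign_eq_one_iff_pos, sign_discr, IsTotallyReal.nrComplexPlaces_eq_zero, pow_zero]

theorem sign_discr_of_isTotallyComplex {K : Type*} [Field K] [NumberField K] [IsTotallyComplex K]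
    {n : ℕ} (hn : finrank ℚ K = 2 * n) : (discr K).sign = (-1) ^ n := by
  rw [sign_discr]
  congr 1
  have := IsTotallyComplex.finrank K
  omega

end DiscriminantSign
-- Square classes and the quadratic fields they define
section QuadraticSubfields
open NumberField Module

theorem Int.exists_squarefree_mul_sq {b : ℤ} (hb : b ≠ 0) :
    ∃ q k : ℤ, Squarefree q ∧ b = q * k ^ 2 := by
  obtain ⟨q, k, hqk, hq⟩ := Nat.sq_mul_squarefree b.natAbs
  refine ⟨b.sign * q, k, ?_, ?_⟩
  · rw [← Int.squarefree_natAbs, Int.natAbs_mul, Int.natAbs_sign_of_ne_zero hb]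
    simpa using hq
  · have h := Int.sign_mul_natAbs b
    rw [← hqk] at h
    push_cast at h
    linarith

theorem Int.isSquare_of_isSquare_mul_of_isSquare {b c : ℤ} (hb : b ≠ 0) (h : IsSquare (b * c))
    (hsq : IsSquare b) : IsSquare c := by
  rw [← Rat.isSquare_intCast_iff] at *
  have hb' : (b : ℚ) ≠ 0 := by exact_mod_cast hb
  have : (c : ℚ) = ((b * c : ℤ) : ℚ) / b := by push_cast; field_simp
  rw [this]
  exact h.div hsq

theorem Finset.prod_mul_prod_eq_prod_symmDiff_mul_sq {ι M : Type*} [DecidableEq ι] [CommMonoid M]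
    (f : ι → M) (s t : Finset ι) :
    (∏ i ∈ s, f i) * ∏ i ∈ t, f i = (∏ i ∈ symmDiff s t, f i) * (∏ i ∈ s ∩ t, f i) ^ 2 := by
  have h : ∏ i ∈ symmDiff s t, f i = (∏ i ∈ s \ t, f i) * ∏ i ∈ t \ s, f i :=
    Finset.prod_union disjoint_sdiff_sdiff
  rw [h, ← Finset.prod_inter_mul_prod_sdiff s t f, ← Finset.prod_inter_mul_prod_sdiff t s f,
    Finset.inter_comm t s, sq]
  ac_rfl

/-- The trivial intermediate field is isomorphic to the base field. -/
noncomputable def ringEquivOfEqBot {k Ω : Type*} [Field k] [Field Ω] [Algebra k Ω]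
    {E : IntermediateField k Ω} (h : E = ⊥) : E ≃+* k :=
  ((IntermediateField.equivOfEq h).trans (IntermediateField.botEquiv k Ω)).toRingEquiv

theorem discr_congr {Ω : Type*} [Field Ω] [Algebra ℚ Ω] {E F : IntermediateField ℚ Ω}
    [NumberField E] [NumberField F] (h : E = F) : discr E = discr F := by
  subst h; rfl

variable {Ω : Type*} [Field Ω] [Algebra ℚ Ω]

theorem HasSqrt.exists_sq_eq {E : IntermediateField ℚ Ω} {b : ℤ} (h : HasSqrt E b) :
    ∃ r : E, r ^ 2 = b := by
  obtain ⟨z, hz, hzb⟩ := h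
  exact ⟨⟨z, hz⟩, Subtype.ext (by simpa using hzb)⟩

variable (Ω) in
theorem discr_sqrtField_empty : discr (sqrtField Ω ∅) = 1 := by
  have := charZero_of_injective_algebraMap (algebraMap ℚ Ω).injective
  rw [← Rat.numberField_discr]
  exact discr_eq_discr_of_ringEquiv _ (ringEquivOfEqBot sqrtField_empty)

variable [IsAlgClosed Ω]

theorem sqrtField_singleton_le_iff {b : ℤ} {E : IntermediateField ℚ Ω} :
    sqrtField Ω {b} ≤ E ↔ HasSqrt E b := by
  rw [sqrtField_le_iff]; simp

theorem hasSqrt_sqrtField_singleton (b : ℤ) : HasSqrt (sqrtField Ω {b}) b :=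
  hasSqrt_sqrtField (Finset.mem_singleton_self b)

theorem sqrtField_singleton_congr {b c : ℤ} (hb : b ≠ 0) (hc : c ≠ 0) (h : IsSquare (b * c)) :
    sqrtField Ω {b} = sqrtField Ω {c} := by
  apply le_antisymm <;> rw [sqrtField_singleton_le_iff]
  · exact (hasSqrt_sqrtField_singleton c).of_mul_isSquare hc (by rwa [mul_comm])
  · exact (hasSqrt_sqrtField_singleton b).of_mul_isSquare hb h

variable (Ω) in
theorem discr_sqrtField_singleton_congr {b c : ℤ} (hb : b ≠ 0) (hc : c ≠ 0)
    (h : IsSquare (b * c)) : discr (sqrtField Ω {b}) = discr (sqrtField Ω {c}) :=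
  discr_congr (sqrtField_singleton_congr hb hc h)

variable (Ω) in
theorem discr_sqrtField_singleton_of_isSquare {b : ℤ} (hb : IsSquare b) :
    discr (sqrtField Ω {b}) = 1 := by
  rw [← discr_sqrtField_empty Ω]
  refine discr_congr (le_antisymm (sqrtField_singleton_le_iff.mpr (hasSqrt_of_isSquare _ hb)) ?_)
  rw [sqrtField_empty]
  exact bot_le

theorem sqrtField_singleton_eq_sup (c : ℤ) :
    sqrtField Ω {c} = sqrtField Ω ∅ ⊔ sqrtField Ω {c} := by
  rw [← sqrtField_insert, insert_empty_eq]

theorem hasSqrt_sqrtField_singleton_iff {c d : ℤ} (hc : c ≠ 0) :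
    HasSqrt (sqrtField Ω {c}) d ↔ IsSquare d ∨ IsSquare (d * c) := by
  constructor
  · intro h
    rw [sqrtField_singleton_eq_sup, sqrtField_empty] at h
    simpa only [hasSqrt_bot_iff] using hasSqrt_or_hasSqrt_mul_of_hasSqrt_sup h
  · rintro (h | h)
    · exact hasSqrt_of_isSquare _ h
    · exact (hasSqrt_sqrtField_singleton c).of_mul_isSquare hc (by rwa [mul_comm])

theorem finrank_sqrtField_singleton {b : ℤ} (hb : ¬ IsSquare b) :
    finrank ℚ (sqrtField Ω {b}) = 2 := by
  rw [sqrtField_singleton_eq_sup, sqrtField_empty, finrank_sup_sqrtField (by rwa [hasSqrt_bot_iff]),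
    IntermediateField.finrank_bot, one_mul]

theorem padicValInt_discr_sqrtField_insert {p : ℕ} (hp : p.Prime) {S : Finset ℤ} {c : ℤ}
    (hc : ¬ HasSqrt (sqrtField Ω S) c) (h : ¬ (p : ℤ) ∣ discr (sqrtField Ω {c})) :
    padicValInt p (discr (sqrtField Ω (insert c S))) =
      2 * padicValInt p (discr (sqrtField Ω S)) := by
  have hc' : ¬ IsSquare c := fun h' => hc (hasSqrt_of_isSquare _ h')
  have hins := sqrtField_insert (Ω := Ω) c S
  have : NumberField ↥(sqrtField Ω S ⊔ sqrtField Ω {c}) := hins ▸ sqrtField.numberField _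
  rw [discr_congr hins, padicValInt_discr_sup hp _ _ ?_ h, finrank_sqrtField_singleton hc']
  rw [finrank_sup_sqrtField hc, finrank_sqrtField_singleton hc']

/-- In the generic case ℚ(√b, √c) is obtained by adjoining √c to either ℚ(√b) or ℚ(√(bc)). Both
descriptions double the exponent at p, so the two exponents agree. The cases where c, b or bc is a
square are checked directly. -/
theorem padicValInt_discr_sqrtField_mul {p : ℕ} (hp : p.Prime) {b c : ℤ} (hb : b ≠ 0)
    (hc : c ≠ 0) (h : ¬ (p : ℤ) ∣ discr (sqrtField Ω {c})) :
    padicValInt p (discr (sqrtField Ω {b * c})) = padicValInt p (discr (sqrtField Ω {b})) := by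
  by_cases hcsq : IsSquare c
  · rw [discr_sqrtField_singleton_congr Ω (mul_ne_zero hb hc) hb]
    obtain ⟨k, rfl⟩ := hcsq
    exact ⟨b * k, by ring⟩
  by_cases hbsq : IsSquare b
  · rw [discr_sqrtField_singleton_of_isSquare Ω hbsq,
      discr_sqrtField_singleton_congr Ω (mul_ne_zero hb hc) hc]
    · simp [padicValInt.eq_zero_of_not_dvd h]
    · obtain ⟨k, rfl⟩ := hbsq
      exact ⟨k * c, by ring⟩
  by_cases hbc : IsSquare (b * c)
  · rw [discr_sqrtField_singleton_of_isSquare Ω hbc, discr_sqrtField_singleton_congr Ω hb hc hbc]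
    simp [padicValInt.eq_zero_of_not_dvd h]
  have h₁ : ¬ HasSqrt (sqrtField Ω {b}) c := by
    rw [hasSqrt_sqrtField_singleton_iff hb, mul_comm]
    tauto
  have h₂ : ¬ HasSqrt (sqrtField Ω {b * c}) c := by
    rw [hasSqrt_sqrtField_singleton_iff (mul_ne_zero hb hc)]
    rintro (h' | h')
    · exact hcsq h'
    · refine hbsq (Int.isSquare_of_isSquare_mul_of_isSquare (mul_ne_zero hc hc) ?_ ⟨c, rfl⟩)
      convert h' using 1; ring
  have heq : sqrtField Ω {c, b} = sqrtField Ω {c, b * c} := by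
    apply le_antisymm <;> rw [sqrtField_le_iff] <;> intro d hd <;>
      simp only [Finset.mem_insert, Finset.mem_singleton] at hd <;> rcases hd with rfl | rfl
    · exact hasSqrt_sqrtField (by simp)
    · exact HasSqrt.of_mul_isSquare (b := d * c * c)
        ((hasSqrt_sqrtField (by simp)).mul (hasSqrt_sqrtField (by simp)))
        (mul_ne_zero (mul_ne_zero hb hc) hc) ⟨d * c, by ring⟩
    · exact hasSqrt_sqrtField (by simp)
    · exact (hasSqrt_sqrtField (by simp)).mul (hasSqrt_sqrtField (by simp))
  have e₁ := padicValInt_discr_sqrtField_insert hp h₁ h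
  have e₂ := padicValInt_discr_sqrtField_insert hp h₂ h
  rw [discr_congr heq] at e₁
  omega

theorem dvd_two_mul_of_dvd_discr_sqrtField {p : ℕ} (hp : p.Prime) {b : ℤ} (hb : ¬ IsSquare b)
    (h : (p : ℤ) ∣ discr (sqrtField Ω {b})) : (p : ℤ) ∣ 2 * b := by
  by_contra hpb
  obtain ⟨r, hr⟩ := (hasSqrt_sqrtField_singleton (Ω := Ω) b).exists_sq_eq
  refine not_dvd_discr_of_not_dvd_two_mul ?_ hb hr hp hpb h
  convert finrank_sqrtField_singleton (Ω := Ω) hb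
  exact Subsingleton.elim _ _

theorem emod_four_ne_one_of_two_dvd_discr_sqrtField {b : ℤ} (hb : ¬ IsSquare b)
    (h : ((2 : ℕ) : ℤ) ∣ discr (sqrtField Ω {b})) : b % 4 ≠ 1 := by
  intro h1
  obtain ⟨r, hr⟩ := (hasSqrt_sqrtField_singleton (Ω := Ω) b).exists_sq_eq
  refine not_two_dvd_discr_of_emod_four_eq_one ?_ hb hr h1 h
  convert finrank_sqrtField_singleton (Ω := Ω) hb
  exact Subsingleton.elim _ _

theorem not_isSquare_of_emod_four {b : ℤ} (h : b % 4 = 2 ∨ b % 4 = 3) : ¬ IsSquare b := by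
  rintro ⟨k, rfl⟩
  rcases Int.even_or_odd' k with ⟨l, rfl | rfl⟩
  · have : 2 * l * (2 * l) = 4 * (l * l) := by ring
    omega
  · have : (2 * l + 1) * (2 * l + 1) = 4 * (l * l + l) + 1 := by ring
    omega

variable (Ω) in
theorem padicValInt_two_discr_sqrtField_of_emod_four_eq_three {b : ℤ} (h : b % 4 = 3) :
    padicValInt 2 (discr (sqrtField Ω {b})) = 2 := by
  obtain ⟨r, hr⟩ := (hasSqrt_sqrtField_singleton (Ω := Ω) b).exists_sq_eq
  refine padicValInt_two_discr_of_emod_four_eq_three ?_ hr h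
  convert finrank_sqrtField_singleton (Ω := Ω) (not_isSquare_of_emod_four (Or.inr h))
  exact Subsingleton.elim _ _

variable (Ω) in
theorem padicValInt_two_discr_sqrtField_of_emod_four_eq_two {b : ℤ} (h : b % 4 = 2) :
    padicValInt 2 (discr (sqrtField Ω {b})) = 3 := by
  obtain ⟨r, hr⟩ := (hasSqrt_sqrtField_singleton (Ω := Ω) b).exists_sq_eq
  refine padicValInt_two_discr_of_emod_four_eq_two ?_ hr h
  convert finrank_sqrtField_singleton (Ω := Ω) (not_isSquare_of_emod_four (Or.inl h))
  exact Subsingleton.elim _ _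

end QuadraticSubfields
-- Independence, change of generators, and ramification at odd primes
section MultiquadraticValuation
open NumberField Module

theorem padicValInt_two_discr_sqrtField_of_finrank_eq_four (Ω : Type*) [Field Ω]
    [Algebra ℚ Ω] {S : Finset ℤ}
    (hS : finrank ℚ (sqrtField Ω S) = 4) {u w : ℤ} (hu : u % 4 = 3) (hw : w % 4 = 2)
    (hu' : HasSqrt (sqrtField Ω S) u) (hw' : HasSqrt (sqrtField Ω S) w) :
    padicValInt 2 (discr (sqrtField Ω S)) = 8 := by
  obtain ⟨v, rfl⟩ : ∃ v, w = 2 * v := ⟨w / 2, by omega⟩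
  obtain ⟨r, hr⟩ := hu'.exists_sq_eq
  obtain ⟨t, ht⟩ := hw'.exists_sq_eq
  refine padicValInt_two_discr_biquadratic ?_ hr ht hu (by omega)
  convert hS
  exact Subsingleton.elim _ _

variable {Ω : Type*} [Field Ω] [Algebra ℚ Ω] [IsAlgClosed Ω]
  {ι : Type*} [DecidableEq ι] {a : ι → ℤ} {s : Finset ι}

theorem isSquare_prod_mul_prod_symmDiff (a : ι → ℤ) (J J' : Finset ι) :
    IsSquare ((∏ j ∈ J, a j) * (∏ j ∈ J', a j) * ∏ j ∈ symmDiff J J', a j) := by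
  rw [Finset.prod_mul_prod_eq_prod_symmDiff_mul_sq]
  exact ⟨(∏ j ∈ symmDiff J J', a j) * ∏ j ∈ J ∩ J', a j, by ring⟩

theorem ne_zero_of_forall_not_isSquare {ι : Type*} {a : ι → ℤ} {s : Finset ι} (h : ∀ J ⊆ s, J.Nonempty → ¬ IsSquare (∏ j ∈ J, a j)) {i : ι}
    (hi : i ∈ s) : a i ≠ 0 := by
  intro h0
  apply h {i} (by simpa using hi) (Finset.singleton_nonempty i)
  simp [h0]

theorem prod_ne_zero_of_forall_not_isSquare {ι : Type*} {a : ι → ℤ} {s : Finset ι}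
    (h : ∀ J ⊆ s, J.Nonempty → ¬ IsSquare (∏ j ∈ J, a j)) {J : Finset ι} (hJ : J ⊆ s) :
    ∏ j ∈ J, a j ≠ 0 :=
  Finset.prod_ne_zero_iff.mpr fun _ hj => ne_zero_of_forall_not_isSquare h (hJ hj)

/-- Otherwise b_J b_J' is a square for some J' not containing i. Then b_(J ∆ J') is a square,
although J ∆ J' contains i. -/
theorem not_hasSqrt_prod_sqrtField_erase
    (h : ∀ J ⊆ s, J.Nonempty → ¬ IsSquare (∏ j ∈ J, a j)) {J : Finset ι} (hJ : J ⊆ s) {i : ι}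
    (hi : i ∈ J) : ¬ HasSqrt (sqrtField Ω ((s.erase i).image a)) (∏ j ∈ J, a j) := by
  intro hsq
  obtain ⟨J', hJ', hsq'⟩ := exists_isSquare_mul_prod_of_hasSqrt a _ hsq
  have hJ's : J' ⊆ s := hJ'.trans (Finset.erase_subset i s)
  refine h (symmDiff J J') ?_ ⟨i, ?_⟩ ?_
  · exact symmDiff_le (hJ.trans le_sup_right) (hJ's.trans le_sup_right)
  · rw [Finset.mem_symmDiff]
    exact Or.inl ⟨hi, fun hiJ' => Finset.notMem_erase i s (hJ' hiJ')⟩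
  · exact Int.isSquare_of_isSquare_mul_of_isSquare
      (mul_ne_zero (prod_ne_zero_of_forall_not_isSquare h hJ)
        (prod_ne_zero_of_forall_not_isSquare h hJ's))
      (isSquare_prod_mul_prod_symmDiff a J J') hsq'

theorem finrank_sqrtField_image (h : ∀ J ⊆ s, J.Nonempty → ¬ IsSquare (∏ j ∈ J, a j)) :
    finrank ℚ (sqrtField Ω (s.image a)) = 2 ^ s.card := by
  induction s using Finset.induction_on with
  | empty => rw [Finset.image_empty, sqrtField_empty, IntermediateField.finrank_bot]; rfl
  | insert i s hi ih =>
    have hn := not_hasSqrt_prod_sqrtField_erase (Ω := Ω) h (J := {i}) (by simp)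
      (Finset.mem_singleton_self i)
    rw [Finset.prod_singleton, Finset.erase_insert hi] at hn
    rw [Finset.image_insert, sqrtField_insert, finrank_sup_sqrtField hn,
      ih fun J hJ => h J (hJ.trans (Finset.subset_insert i s)), Finset.card_insert_of_notMem hi,
      pow_succ]

/-- The exchange step of the induction: modulo squares, a_i is b_J times the product of the other
a_j with j ∈ J. -/
theorem sqrtField_image_eq_insert_prod (h : ∀ i ∈ s, a i ≠ 0) {J : Finset ι}
    (hJ : J ⊆ s) {i : ι} (hi : i ∈ J) :
    sqrtField Ω (s.image a) = sqrtField Ω (insert (∏ j ∈ J, a j) ((s.erase i).image a)) := by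
  have hprod : ∀ {E : IntermediateField ℚ Ω} {J : Finset ι}, (∀ j ∈ J, HasSqrt E (a j)) →
      HasSqrt E (∏ j ∈ J, a j) := by
    intro E J hE
    induction J using Finset.induction_on with
    | empty => exact hasSqrt_of_isSquare _ (by simp)
    | insert j J hj ih =>
      rw [Finset.prod_insert hj]
      exact (hE j (Finset.mem_insert_self j J)).mul
        (ih fun k hk => hE k (Finset.mem_insert_of_mem hk))
  apply le_antisymm <;> rw [sqrtField_le_iff] <;> intro d hd
  · obtain ⟨j, hj, rfl⟩ := Finset.mem_image.mp hd
    by_cases hji : j = i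
    · subst hji
      have h₁ : HasSqrt (sqrtField Ω (insert (∏ j ∈ J, a j) ((s.erase j).image a)))
          (∏ k ∈ J.erase j, a k) := hprod fun k hk => hasSqrt_sqrtField <|
        Finset.mem_insert_of_mem <| Finset.mem_image_of_mem a <|
          Finset.erase_subset_erase j hJ hk
      have h₂ := (hasSqrt_sqrtField (Ω := Ω)
        (Finset.mem_insert_self (∏ j ∈ J, a j) ((s.erase j).image a))).mul h₁
      rw [← Finset.mul_prod_erase J a hi] at h₂ ⊢
      refine h₂.of_mul_isSquare ?_ ⟨a j * ∏ k ∈ J.erase j, a k, by ring⟩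
      have : ∏ k ∈ J.erase j, a k ≠ 0 := Finset.prod_ne_zero_iff.mpr fun k hk =>
        h k (hJ (Finset.mem_of_mem_erase hk))
      exact mul_ne_zero (mul_ne_zero (h j hj) this) this
    · exact hasSqrt_sqrtField (Finset.mem_insert_of_mem
        (Finset.mem_image_of_mem a (Finset.mem_erase.mpr ⟨hji, hj⟩)))
  · rcases Finset.mem_insert.mp hd with rfl | hd
    · exact hprod fun j hj => hasSqrt_sqrtField (Finset.mem_image_of_mem a (hJ hj))
    · exact hasSqrt_sqrtField (Finset.image_subset_image (Finset.erase_subset i s) hd)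

/-- The map J' ↦ J ∆ J' permutes the subsets of t, so the subsets containing i contribute as much as
those that do not. -/
theorem sum_powerset_insert_eq_two_mul {i : ι} {t : Finset ι} (hi : i ∉ t) {J : Finset ι}
    (hJ : J ⊆ t) {g : Finset ι → ℕ}
    (hg : ∀ J' ⊆ t, g (insert i (symmDiff J J')) = g J') :
    ∑ J' ∈ (insert i t).powerset, g J' = 2 * ∑ J' ∈ t.powerset, g J' := by
  rw [Finset.sum_powerset_insert hi, two_mul]
  congr 1
  have hmem : ∀ J' ∈ t.powerset, symmDiff J J' ∈ t.powerset := fun J' hJ' =>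
    Finset.mem_powerset.mpr (symmDiff_le (hJ.trans le_sup_right)
      ((Finset.mem_powerset.mp hJ').trans le_sup_right))
  refine Finset.sum_nbij' (symmDiff J) (symmDiff J) hmem hmem
    (fun _ _ => symmDiff_symmDiff_cancel_left _ _) (fun _ _ => symmDiff_symmDiff_cancel_left _ _) ?_
  intro J' hJ'
  rw [← hg _ (Finset.mem_powerset.mp (hmem J' hJ')), symmDiff_symmDiff_cancel_left]

/-- Ramification at p forces a_i = p m k² with p ∤ m. For two such indices, a_i a_j is m m' up to
squares, so ℚ(√(a_i a_j)) is unramified at p. -/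
theorem card_le_one_of_odd_of_forall_dvd {p : ℕ} (hp : p.Prime) (hp2 : p ≠ 2)
    (h : ∀ J ⊆ s, J.Nonempty → ¬ IsSquare (∏ j ∈ J, a j))
    (hdvd : ∀ J ⊆ s, J.Nonempty → (p : ℤ) ∣ discr (sqrtField Ω {∏ j ∈ J, a j})) : s.card ≤ 1 := by
  have hp' := Nat.prime_iff_prime_int.mp hp
  have hpt : ¬ (p : ℤ) ∣ 2 := fun h2 =>
    hp2 ((Nat.prime_dvd_prime_iff_eq hp Nat.prime_two).mp (by exact_mod_cast h2))
  have key : ∀ i ∈ s, ∃ m k : ℤ, ¬ (p : ℤ) ∣ m ∧ a i = p * m * k ^ 2 := by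
    intro i hi
    have hns : ¬ IsSquare (a i) := by
      simpa using h {i} (by simpa using hi) (Finset.singleton_nonempty i)
    have hd : (p : ℤ) ∣ discr (sqrtField Ω {a i}) := by
      have := hdvd {i} (by simpa using hi) (Finset.singleton_nonempty i)
      rwa [Finset.prod_singleton] at this
    have hai := ne_zero_of_forall_not_isSquare h hi
    obtain ⟨q, k, hq, hqk⟩ := Int.exists_squarefree_mul_sq hai
    rw [discr_sqrtField_singleton_congr Ω hai hq.ne_zero ⟨q * k, by rw [hqk]; ring⟩] at hd
    have hqns : ¬ IsSquare q := by
      rintro ⟨l, rfl⟩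
      exact hns ⟨l * k, by rw [hqk]; ring⟩
    obtain ⟨m, rfl⟩ := (hp'.dvd_mul.mp
      (dvd_two_mul_of_dvd_discr_sqrtField hp hqns hd)).resolve_left hpt
    refine ⟨m, k, ?_, hqk⟩
    rintro ⟨l, rfl⟩
    exact hp'.not_isUnit (hq p ⟨l, by ring⟩)
  by_contra! hcard
  obtain ⟨i, hi, j, hj, hij⟩ := Finset.one_lt_card.mp hcard
  obtain ⟨m, k, hm, hmk⟩ := key i hi
  obtain ⟨m', k', hm', hmk'⟩ := key j hj
  have hsub : {i, j} ⊆ s := by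
    intro x hx
    rcases Finset.mem_insert.mp hx with rfl | hx
    · exact hi
    · rwa [Finset.mem_singleton.mp hx]
  have hd := hdvd {i, j} hsub ⟨i, by simp⟩
  have hns := h {i, j} hsub ⟨i, by simp⟩
  have h0 := prod_ne_zero_of_forall_not_isSquare h hsub
  rw [Finset.prod_pair hij] at hd hns h0
  have hmm : m * m' ≠ 0 := mul_ne_zero (by rintro rfl; simp at hm) (by rintro rfl; simp at hm')
  rw [discr_sqrtField_singleton_congr Ω h0 hmm
    ⟨p * m * m' * k * k', by rw [hmk, hmk']; ring⟩] at hd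
  have hmns : ¬ IsSquare (m * m') := by
    rintro ⟨l, hl⟩
    refine hns ⟨p * l * k * k', ?_⟩
    rw [hmk, hmk']
    linear_combination (p * k * k' : ℤ) ^ 2 * hl
  rcases hp'.dvd_mul.mp (dvd_two_mul_of_dvd_discr_sqrtField hp hmns hd) with h2 | h2
  · exact hpt h2
  · rcases hp'.dvd_mul.mp h2 with h2 | h2
    · exact hm h2
    · exact hm' h2

end MultiquadraticValuation
-- The prime 2, and the induction for all primes
section MultiquadraticDiscriminant
open NumberField Module

variable {Ω : Type*} [Field Ω] [Algebra ℚ Ω] [IsAlgClosed Ω]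
  {ι : Type*} [DecidableEq ι] {a : ι → ℤ} {s : Finset ι}

/-- Take for q the squarefree part: squarefreeness excludes 0 mod 4, ramification at 2 excludes 1
mod 4. -/
theorem exists_emod_four_of_forall_two_dvd {ι : Type*} {a : ι → ℤ} {s : Finset ι}
    (h : ∀ J ⊆ s, J.Nonempty → ¬ IsSquare (∏ j ∈ J, a j))
    (hdvd : ∀ J ⊆ s, J.Nonempty → ((2 : ℕ) : ℤ) ∣ discr (sqrtField Ω {∏ j ∈ J, a j})) {i : ι}
    (hi : i ∈ s) : ∃ q k : ℤ, (q % 4 = 2 ∨ q % 4 = 3) ∧ a i = q * k ^ 2 := by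
  have hns : ¬ IsSquare (a i) := by
    simpa using h {i} (by simpa using hi) (Finset.singleton_nonempty i)
  have hd := hdvd {i} (by simpa using hi) (Finset.singleton_nonempty i)
  rw [Finset.prod_singleton] at hd
  have hai := ne_zero_of_forall_not_isSquare h hi
  obtain ⟨q, k, hq, hqk⟩ := Int.exists_squarefree_mul_sq hai
  rw [discr_sqrtField_singleton_congr Ω hai hq.ne_zero ⟨q * k, by rw [hqk]; ring⟩] at hd
  have hqns : ¬ IsSquare q := by
    rintro ⟨l, rfl⟩
    exact hns ⟨l * k, by rw [hqk]; ring⟩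
  have h1 := emod_four_ne_one_of_two_dvd_discr_sqrtField hqns hd
  have h0 : q % 4 ≠ 0 := by
    intro h0
    have := hq 2 (by obtain ⟨l, rfl⟩ := Int.dvd_of_emod_eq_zero h0; exact ⟨l, by ring⟩)
    exact Int.prime_two.not_isUnit this
  exact ⟨q, k, by omega, hqk⟩

theorem emod_four_ne_one_of_forall_two_dvd {ι : Type*} {a : ι → ℤ} {s : Finset ι}
    (h : ∀ J ⊆ s, J.Nonempty → ¬ IsSquare (∏ j ∈ J, a j))
    (hdvd : ∀ J ⊆ s, J.Nonempty → ((2 : ℕ) : ℤ) ∣ discr (sqrtField Ω {∏ j ∈ J, a j}))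
    {J : Finset ι} (hJ : J ⊆ s) (hne : J.Nonempty) {m : ℤ} (hm : IsSquare ((∏ j ∈ J, a j) * m)) :
    m % 4 ≠ 1 := by
  intro h1
  have hm0 : m ≠ 0 := by rintro rfl; simp at h1
  have hd := hdvd J hJ hne
  rw [discr_sqrtField_singleton_congr Ω (prod_ne_zero_of_forall_not_isSquare h hJ) hm0 hm] at hd
  refine emod_four_ne_one_of_two_dvd_discr_sqrtField (fun hsq => h J hJ hne ?_) hd h1
  exact Int.isSquare_of_isSquare_mul_of_isSquare hm0 (by rwa [mul_comm]) hsq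

theorem sum_powerset_singleton (g : Finset ι → ℕ) (i : ι) :
    ∑ J ∈ ({i} : Finset ι).powerset, g J = g ∅ + g {i} := by
  have h : ({i} : Finset ι) = insert i ∅ := rfl
  rw [h, Finset.sum_powerset_insert (Finset.notMem_empty i), Finset.powerset_empty,
    Finset.sum_singleton, Finset.sum_singleton]

theorem sum_powerset_pair (g : Finset ι → ℕ) {i j : ι} (hij : i ≠ j) :
    ∑ J ∈ ({i, j} : Finset ι).powerset, g J = g ∅ + g {j} + (g {i} + g {i, j}) := by
  rw [Finset.sum_powerset_insert (by simpa using hij), sum_powerset_singleton,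
    sum_powerset_singleton fun J => g (insert i J), insert_empty_eq]

/-- The three quadratic subfields have exponents 2, 3, 3 in some order, with sum 8. When q and r are
both even, the subfield with radicand 3 mod 4 is generated by the square root of (q/2)(r/2). -/
theorem padicValInt_two_discr_sqrtField_pair {i j : ι} (hij : i ≠ j)
    (h : ∀ J ⊆ {i, j}, J.Nonempty → ¬ IsSquare (∏ j ∈ J, a j)) {q r k l : ℤ}
    (hi : a i = q * k ^ 2) (hj : a j = r * l ^ 2) (hr : r % 4 = 2)
    (hq : q % 4 = 3 ∨ q % 4 = 2 ∧ (q / 2 * (r / 2)) % 4 = 3) :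
    padicValInt 2 (discr (sqrtField Ω (({i, j} : Finset ι).image a))) =
      ∑ J ∈ ({i, j} : Finset ι).powerset, padicValInt 2 (discr (sqrtField Ω {∏ j ∈ J, a j})) := by
  have hai : a i ≠ 0 := ne_zero_of_forall_not_isSquare h (by simp)
  have haj : a j ≠ 0 := ne_zero_of_forall_not_isSquare h (by simp)
  have hr0 : r ≠ 0 := by rintro rfl; simp at hr
  have hq0 : q ≠ 0 := by rintro rfl; simp at hq
  have hrank : finrank ℚ (sqrtField Ω (({i, j} : Finset ι).image a)) = 4 := by
    rw [finrank_sqrtField_image h, Finset.card_pair hij]; rfl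
  have hsi : HasSqrt (sqrtField Ω (({i, j} : Finset ι).image a)) (a i) :=
    hasSqrt_sqrtField (by simp)
  have hsj : HasSqrt (sqrtField Ω (({i, j} : Finset ι).image a)) (a j) :=
    hasSqrt_sqrtField (by simp)
  have hsr := hsj.of_mul_isSquare haj (c := r) ⟨r * l, by rw [hj]; ring⟩
  have hi' : IsSquare (a i * q) := ⟨q * k, by rw [hi]; ring⟩
  have hj' : IsSquare (a j * r) := ⟨r * l, by rw [hj]; ring⟩
  have hsum : ∑ J ∈ ({i, j} : Finset ι).powerset,
      padicValInt 2 (discr (sqrtField Ω {∏ j ∈ J, a j})) =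
      padicValInt 2 (discr (sqrtField Ω {q})) + 3 +
        padicValInt 2 (discr (sqrtField Ω {a i * a j})) := by
    rw [sum_powerset_pair _ hij, Finset.prod_empty, Finset.prod_singleton, Finset.prod_singleton,
      Finset.prod_pair hij]
    rw [discr_sqrtField_singleton_of_isSquare Ω IsSquare.one,
      discr_sqrtField_singleton_congr Ω haj hr0 hj', discr_sqrtField_singleton_congr Ω hai hq0 hi',
      padicValInt_two_discr_sqrtField_of_emod_four_eq_two Ω hr, padicValInt.one]
    ring
  rw [hsum]
  rcases hq with hq | ⟨hq, hqr⟩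
  · have hsq := hsi.of_mul_isSquare hai hi'
    rw [padicValInt_two_discr_sqrtField_of_finrank_eq_four Ω hrank hq hr hsq hsr,
      padicValInt_two_discr_sqrtField_of_emod_four_eq_three Ω hq,
      discr_sqrtField_singleton_congr Ω (mul_ne_zero hai haj) (mul_ne_zero hq0 hr0)
        (by rw [mul_mul_mul_comm]; exact hi'.mul hj'),
      padicValInt_two_discr_sqrtField_of_emod_four_eq_two Ω (by simp [Int.mul_emod, hq, hr])]
  · obtain ⟨x, rfl⟩ : ∃ x, q = 2 * x := ⟨q / 2, by omega⟩
    obtain ⟨y, rfl⟩ : ∃ y, r = 2 * y := ⟨r / 2, by omega⟩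
    rw [Int.mul_ediv_cancel_left _ two_ne_zero, Int.mul_ediv_cancel_left _ two_ne_zero] at hqr
    have hxy : x * y ≠ 0 := mul_ne_zero (right_ne_zero_of_mul hq0) (right_ne_zero_of_mul hr0)
    have hsq : IsSquare (a i * a j * (x * y)) := ⟨2 * x * y * k * l, by rw [hi, hj]; ring⟩
    rw [padicValInt_two_discr_sqrtField_of_finrank_eq_four Ω hrank hqr hr
        ((hsi.mul hsj).of_mul_isSquare (mul_ne_zero hai haj) hsq) hsr,
      padicValInt_two_discr_sqrtField_of_emod_four_eq_two Ω hq,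
      discr_sqrtField_singleton_congr Ω (mul_ne_zero hai haj) hxy hsq,
      padicValInt_two_discr_sqrtField_of_emod_four_eq_three Ω hqr]

theorem padicValInt_discr_sqrtField_image_of_card_le_one {p : ℕ} (hs : s.card ≤ 1) :
    padicValInt p (discr (sqrtField Ω (s.image a))) =
      ∑ J ∈ s.powerset, padicValInt p (discr (sqrtField Ω {∏ j ∈ J, a j})) := by
  rcases Nat.le_one_iff_eq_zero_or_eq_one.mp hs with hs | hs
  · rw [Finset.card_eq_zero] at hs
    subst hs
    rw [Finset.powerset_empty, Finset.sum_singleton, Finset.prod_empty, Finset.image_empty,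
      discr_sqrtField_singleton_of_isSquare Ω IsSquare.one, discr_sqrtField_empty Ω]
  · obtain ⟨i, rfl⟩ := Finset.card_eq_one.mp hs
    rw [Finset.image_singleton, sum_powerset_singleton, Finset.prod_empty, Finset.prod_singleton]
    rw [discr_sqrtField_singleton_of_isSquare Ω IsSquare.one, padicValInt.one, zero_add]

/-- No b_J may be congruent to 1 mod 4 up to squares. This excludes two radicands that are 3 mod 4,
and any three radicands, which leaves at most one generator or the biquadratic case. -/
theorem padicValInt_two_discr_sqrtField_image_of_forall_two_dvd
    (h : ∀ J ⊆ s, J.Nonempty → ¬ IsSquare (∏ j ∈ J, a j))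
    (hdvd : ∀ J ⊆ s, J.Nonempty → ((2 : ℕ) : ℤ) ∣ discr (sqrtField Ω {∏ j ∈ J, a j})) :
    padicValInt 2 (discr (sqrtField Ω (s.image a))) =
      ∑ J ∈ s.powerset, padicValInt 2 (discr (sqrtField Ω {∏ j ∈ J, a j})) := by
  have key := fun i (hi : i ∈ s) => exists_emod_four_of_forall_two_dvd h hdvd hi
  choose! q k hq hqk using key
  have odd_odd : ∀ i ∈ s, ∀ j ∈ s, i ≠ j → q i % 4 = 3 → q j % 4 = 3 → False := by
    intro i hi j hj hij hi3 hj3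
    refine emod_four_ne_one_of_forall_two_dvd h hdvd (J := {i, j}) (m := q i * q j)
      (by simp [Finset.insert_subset_iff, hi, hj]) ⟨i, by simp⟩ ?_ (by simp [Int.mul_emod, hi3, hj3])
    rw [Finset.prod_pair hij, hqk i hi, hqk j hj]
    exact ⟨q i * q j * k i * k j, by ring⟩
  have two_mul_half : ∀ i, q i % 4 = 2 → q i = 2 * (q i / 2) := fun i hi => by omega
  have even_even : ∀ i ∈ s, ∀ j ∈ s, i ≠ j → q i % 4 = 2 → q j % 4 = 2 →
      (q i / 2 * (q j / 2)) % 4 = 3 := by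
    intro i hi j hj hij hi2 hj2
    have h1 := emod_four_ne_one_of_forall_two_dvd h hdvd (J := {i, j}) (m := q i / 2 * (q j / 2))
      (by simp [Finset.insert_subset_iff, hi, hj]) ⟨i, by simp⟩ (by
        rw [Finset.prod_pair hij, hqk i hi, hqk j hj, two_mul_half i hi2, two_mul_half j hj2,
          Int.mul_ediv_cancel_left _ two_ne_zero, Int.mul_ediv_cancel_left _ two_ne_zero]
        exact ⟨2 * (q i / 2) * (q j / 2) * k i * k j, by ring⟩)
    have hodd : Odd (q i / 2 * (q j / 2)) :=
      (Int.odd_iff.mpr (by omega)).mul (Int.odd_iff.mpr (by omega))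
    have := Int.odd_iff.mp hodd
    omega
  have odd_even_even : ∀ i ∈ s, ∀ j ∈ s, ∀ l ∈ s, i ≠ j → i ≠ l → j ≠ l → q i % 4 = 3 →
      q j % 4 = 2 → q l % 4 = 2 → False := by
    intro i hi j hj l hl hij hil hjl hi3 hj2 hl2
    have hjl3 := even_even j hj l hl hjl hj2 hl2
    refine emod_four_ne_one_of_forall_two_dvd h hdvd (J := {i, j, l})
      (m := q i * (q j / 2 * (q l / 2)))
      (by simp [Finset.insert_subset_iff, hi, hj, hl]) ⟨i, by simp⟩ ?_
      (by rw [Int.mul_emod, hi3, hjl3]; rfl)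
    rw [Finset.prod_insert (by simp [hij, hil]), Finset.prod_pair hjl, hqk i hi, hqk j hj,
      hqk l hl, two_mul_half j hj2, two_mul_half l hl2,
      Int.mul_ediv_cancel_left _ two_ne_zero, Int.mul_ediv_cancel_left _ two_ne_zero]
    exact ⟨2 * q i * (q j / 2) * (q l / 2) * k i * k j * k l, by ring⟩
  -- The three pairwise products of the halves are all 3 mod 4, so together they give 3 mod 4; yet
  -- their product is a square.
  have even_even_even : ∀ i ∈ s, ∀ j ∈ s, ∀ l ∈ s, i ≠ j → i ≠ l → j ≠ l → q i % 4 = 2 →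
      q j % 4 = 2 → q l % 4 = 2 → False := by
    intro i hi j hj l hl hij hil hjl hi2 hj2 hl2
    have h₁ := even_even i hi j hj hij hi2 hj2
    have h₂ := even_even i hi l hl hil hi2 hl2
    have h₃ := even_even j hj l hl hjl hj2 hl2
    refine not_isSquare_of_emod_four (b := (q i / 2 * (q j / 2)) * (q i / 2 * (q l / 2)) *
      (q j / 2 * (q l / 2))) (Or.inr ?_) ⟨q i / 2 * (q j / 2) * (q l / 2), by ring⟩
    rw [Int.mul_emod, Int.mul_emod (q i / 2 * (q j / 2)), h₁, h₂, h₃]; rfl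
  have hcard : s.card ≤ 2 := by
    by_contra! hcard
    obtain ⟨i, j, l, hi, hj, hl, hij, hil, hjl⟩ := Finset.two_lt_card_iff.mp hcard
    rcases hq i hi with h1 | h1 <;> rcases hq j hj with h2 | h2 <;> rcases hq l hl with h3 | h3
    · exact even_even_even i hi j hj l hl hij hil hjl h1 h2 h3
    · exact odd_even_even l hl i hi j hj hil.symm hjl.symm hij h3 h1 h2
    · exact odd_even_even j hj i hi l hl hij.symm hjl hil h2 h1 h3
    · exact odd_odd j hj l hl hjl h2 h3
    · exact odd_even_even i hi j hj l hl hij hil hjl h1 h2 h3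
    · exact odd_odd i hi l hl hil h1 h3
    · exact odd_odd i hi j hj hij h1 h2
    · exact odd_odd i hi j hj hij h1 h2
  rcases Nat.lt_or_ge 1 s.card with hs | hs
  · obtain ⟨i, j, hij, rfl⟩ := Finset.card_eq_two.mp (show s.card = 2 by omega)
    have hi : i ∈ ({i, j} : Finset ι) := by simp
    have hj : j ∈ ({i, j} : Finset ι) := by simp
    rcases hq i hi with h1 | h1 <;> rcases hq j hj with h2 | h2
    · exact padicValInt_two_discr_sqrtField_pair hij h (hqk i hi) (hqk j hj) h2
        (Or.inr ⟨h1, even_even i hi j hj hij h1 h2⟩)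
    · rw [Finset.pair_comm i j] at h ⊢
      exact padicValInt_two_discr_sqrtField_pair hij.symm h (hqk j hj)
        (hqk i hi) h1 (Or.inl h2)
    · exact padicValInt_two_discr_sqrtField_pair hij h (hqk i hi) (hqk j hj) h2
        (Or.inl h1)
    · exact (odd_odd i hi j hj hij h1 h2).elim
  · exact padicValInt_discr_sqrtField_image_of_card_le_one hs

theorem padicValInt_discr_sqrtField_image {p : ℕ} (hp : p.Prime)
    (h : ∀ J ⊆ s, J.Nonempty → ¬ IsSquare (∏ j ∈ J, a j)) :
    padicValInt p (discr (sqrtField Ω (s.image a))) =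
      ∑ J ∈ s.powerset, padicValInt p (discr (sqrtField Ω {∏ j ∈ J, a j})) := by
  induction s using Finset.strongInduction with
  | H s ih =>
    by_cases hdvd : ∀ J ⊆ s, J.Nonempty → (p : ℤ) ∣ discr (sqrtField Ω {∏ j ∈ J, a j})
    · rcases eq_or_ne p 2 with rfl | hp2
      · exact padicValInt_two_discr_sqrtField_image_of_forall_two_dvd h hdvd
      · exact padicValInt_discr_sqrtField_image_of_card_le_one
          (card_le_one_of_odd_of_forall_dvd hp hp2 h hdvd)
    push Not at hdvd
    -- Now ℚ(√b_J) is unramified at p, so √b_J replaces √a_i and the induction hypothesis applies to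
    -- the remaining generators.
    obtain ⟨J, hJ, ⟨i, hi⟩, hpJ⟩ := hdvd
    have his := hJ hi
    have hsub : s.erase i ⊆ s := Finset.erase_subset i s
    rw [discr_congr (sqrtField_image_eq_insert_prod
        (fun _ hj => ne_zero_of_forall_not_isSquare h hj) hJ hi),
      padicValInt_discr_sqrtField_insert hp (not_hasSqrt_prod_sqrtField_erase h hJ hi) hpJ,
      ih _ (Finset.erase_ssubset his) fun J' hJ' => h J' (hJ'.trans hsub)]
    have hJi : J.erase i ⊆ s.erase i := Finset.erase_subset_erase i hJ
    rw [← sum_powerset_insert_eq_two_mul (Finset.notMem_erase i s) hJi, Finset.insert_erase his]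
    intro J' hJ'
    have hiJ : i ∉ symmDiff (J.erase i) J' := by
      rw [Finset.mem_symmDiff]
      rintro (⟨h', -⟩ | ⟨h', -⟩)
      · exact Finset.notMem_erase i J h'
      · exact Finset.notMem_erase i s (hJ' h')
    have hsd : symmDiff (J.erase i) J' ⊆ s :=
      symmDiff_le ((hJi.trans hsub).trans le_sup_right) ((hJ'.trans hsub).trans le_sup_right)
    have hJ'0 := prod_ne_zero_of_forall_not_isSquare h (hJ'.trans hsub)
    have hJ0 := prod_ne_zero_of_forall_not_isSquare h hJ
    -- As i ∉ J', inserting i into (J \ {i}) ∆ J' gives J ∆ J', whose product is b_J' b_J up to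
    -- squares.
    rw [← padicValInt_discr_sqrtField_mul hp hJ'0 hJ0 hpJ]
    congr 1
    refine discr_sqrtField_singleton_congr Ω
      (prod_ne_zero_of_forall_not_isSquare h (Finset.insert_subset his hsd))
      (mul_ne_zero hJ'0 hJ0) ?_
    obtain ⟨l, hl⟩ := isSquare_prod_mul_prod_symmDiff a (J.erase i) J'
    rw [Finset.prod_insert hiJ, ← Finset.mul_prod_erase J a hi]
    exact ⟨a i * l, by linear_combination a i ^ 2 * hl⟩

end MultiquadraticDiscriminant
-- Signs, and the discriminant formula
section DiscriminantFormula
open NumberField Module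

variable {Ω : Type*} [Field Ω] [Algebra ℚ Ω] [IsAlgClosed Ω]
  {ι : Type*} [DecidableEq ι] {a : ι → ℤ} {s : Finset ι}

/-- With t = s \ {i} and P the product over the subsets of t, the whole product is f_i^(2^|t|) P².
The exponent is even because t is nonempty. -/
theorem prod_powerset_prod_pos {f : ι → ℤ} (hf : ∀ i ∈ s, f i ≠ 0) (hs : 2 ≤ s.card) :
    0 < ∏ J ∈ s.powerset, ∏ j ∈ J, f j := by
  obtain ⟨i, hi⟩ := Finset.card_pos.mp (show 0 < s.card by omega)
  have hit := Finset.notMem_erase i s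
  have hcard := Finset.card_erase_of_mem hi
  set t := s.erase i
  have hst : s = insert i t := (Finset.insert_erase hi).symm
  have hprod : ∏ J ∈ t.powerset, ∏ j ∈ insert i J, f j =
      f i ^ 2 ^ t.card * ∏ J ∈ t.powerset, ∏ j ∈ J, f j := by
    rw [← Finset.card_powerset, ← Finset.prod_const, ← Finset.prod_mul_distrib]
    refine Finset.prod_congr rfl fun J hJ => ?_
    rw [Finset.prod_insert fun hiJ => hit (Finset.mem_powerset.mp hJ hiJ)]
  have hne : ∏ J ∈ t.powerset, ∏ j ∈ J, f j ≠ 0 :=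
    Finset.prod_ne_zero_iff.mpr fun J hJ => Finset.prod_ne_zero_iff.mpr fun j hj =>
      hf j (hst ▸ Finset.mem_insert_of_mem (Finset.mem_powerset.mp hJ hj))
  rw [hst, Finset.prod_powerset_insert hit, hprod, mul_left_comm]
  refine mul_pos (Even.pow_pos ?_ (hf i hi)) (mul_self_pos.mpr hne)
  exact (Nat.even_pow' (by omega)).mpr even_two

theorem discr_sqrtField_singleton_neg {b : ℤ} (hb : b < 0) :
    discr (sqrtField Ω {b}) < 0 := by
  obtain ⟨r, hr⟩ := (hasSqrt_sqrtField_singleton (Ω := Ω) b).exists_sq_eq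
  have := isTotallyComplex_of_sq_eq_neg hr hb
  have hb' : ¬ IsSquare b := fun h => absurd h.nonneg (by omega)
  rw [← Int.sign_eq_neg_one_iff_neg, sign_discr_of_isTotallyComplex (n := 1), pow_one]
  convert finrank_sqrtField_singleton (Ω := Ω) hb'
  exact Subsingleton.elim _ _

/-- The discriminant has the sign of b, stated in a form that can be multiplied over all subsets. -/
theorem discr_sqrtField_singleton_mul_self_pos {b : ℤ} (hb : b ≠ 0) :
    0 < discr (sqrtField Ω {b}) * b := by
  rcases lt_or_gt_of_ne hb with hb | hb
  · exact mul_pos_of_neg_of_neg (discr_sqrtField_singleton_neg hb) hb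
  · exact mul_pos (discr_sqrtField_pos (by simpa using hb)) hb

theorem discr_sqrtField_image_pos (h : ∀ J ⊆ s, J.Nonempty → ¬ IsSquare (∏ j ∈ J, a j))
    (hs : 2 ≤ s.card ∨ ∀ i ∈ s, 0 < a i) : 0 < discr (sqrtField Ω (s.image a)) := by
  by_cases hpos : ∀ i ∈ s, 0 < a i
  · refine discr_sqrtField_pos fun b hb => ?_
    obtain ⟨i, hi, rfl⟩ := Finset.mem_image.mp hb
    exact hpos i hi
  have hs' := hs.resolve_right hpos
  push Not at hpos
  obtain ⟨i, hi, hai⟩ := hpos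
  obtain ⟨r, hr⟩ := (hasSqrt_sqrtField (Ω := Ω) (Finset.mem_image_of_mem a hi)).exists_sq_eq
  have := isTotallyComplex_of_sq_eq_neg hr
    (lt_of_le_of_ne hai (ne_zero_of_forall_not_isSquare h hi))
  -- A negative a_i makes the field totally complex, with 2^(n-1) complex places; this number is
  -- even for n ≥ 2.
  rw [← Int.sign_eq_one_iff_pos, sign_discr_of_isTotallyComplex (n := 2 ^ (s.card - 1))]
  · exact Even.neg_one_pow ((Nat.even_pow' (by omega)).mpr even_two)
  · rw [← pow_succ', Nat.sub_add_cancel (by omega)]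
    convert finrank_sqrtField_image (Ω := Ω) h
    exact Subsingleton.elim _ _

theorem padicValInt_prod {α : Type*} {p : ℕ} [Fact p.Prime] (t : Finset α) {f : α → ℤ}
    (hf : ∀ i ∈ t, f i ≠ 0) :
    padicValInt p (∏ i ∈ t, f i) = ∑ i ∈ t, padicValInt p (f i) := by
  classical
  induction t using Finset.induction_on with
  | empty => simp
  | insert i t hi ih =>
    have hf' : ∀ j ∈ t, f j ≠ 0 := fun j hj => hf j (Finset.mem_insert_of_mem hj)
    rw [Finset.prod_insert hi, Finset.sum_insert hi,
      padicValInt.mul (hf i (Finset.mem_insert_self i t)) (Finset.prod_ne_zero_iff.mpr hf'), ih hf']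

/-- The discriminant of a multiquadratic field is the product of the discriminants of the fields
generated by the square roots of all the subproducts. -/
theorem discr_sqrtField_image (h : ∀ J ⊆ s, J.Nonempty → ¬ IsSquare (∏ j ∈ J, a j)) :
    discr (sqrtField Ω (s.image a)) = ∏ J ∈ s.powerset, discr (sqrtField Ω {∏ j ∈ J, a j}) := by
  have hne : ∏ J ∈ s.powerset, discr (sqrtField Ω {∏ j ∈ J, a j}) ≠ 0 :=
    Finset.prod_ne_zero_iff.mpr fun _ _ => discr_ne_zero _
  have habs : (discr (sqrtField Ω (s.image a))).natAbs =
      (∏ J ∈ s.powerset, discr (sqrtField Ω {∏ j ∈ J, a j})).natAbs := by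
    rw [Nat.eq_iff_prime_padicValNat_eq _ _ (Int.natAbs_ne_zero.mpr (discr_ne_zero _))
      (Int.natAbs_ne_zero.mpr hne)]
    intro p hp
    have := Fact.mk hp
    exact (padicValInt_discr_sqrtField_image hp h).trans
      (padicValInt_prod _ fun _ _ => discr_ne_zero _).symm
  -- With at most one generator the formula is immediate, the empty subset contributing discr ℚ = 1.
  -- Otherwise both sides are positive, and equal absolute values suffice.
  rcases Nat.lt_or_ge s.card 2 with hs | hs
  · rcases Nat.lt_or_ge s.card 1 with hs' | hs'
    · obtain rfl := Finset.card_eq_zero.mp (show s.card = 0 by omega)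
      rw [Finset.powerset_empty, Finset.prod_singleton, Finset.prod_empty, Finset.image_empty,
        discr_sqrtField_singleton_of_isSquare Ω IsSquare.one, discr_sqrtField_empty Ω]
    · obtain ⟨i, rfl⟩ := Finset.card_eq_one.mp (show s.card = 1 by omega)
      have hi : ({i} : Finset ι) = insert i ∅ := rfl
      rw [Finset.image_singleton, hi, Finset.prod_powerset_insert (Finset.notMem_empty i),
        Finset.powerset_empty, Finset.prod_singleton, Finset.prod_singleton, insert_empty_eq,
        Finset.prod_empty, Finset.prod_singleton,
        discr_sqrtField_singleton_of_isSquare Ω IsSquare.one, one_mul]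
  · have hpos : 0 < ∏ J ∈ s.powerset, discr (sqrtField Ω {∏ j ∈ J, a j}) := by
      have h₁ := prod_powerset_prod_pos (fun i hi => ne_zero_of_forall_not_isSquare h hi) hs
      have h₂ : 0 < ∏ J ∈ s.powerset, discr (sqrtField Ω {∏ j ∈ J, a j}) * ∏ j ∈ J, a j :=
        Finset.prod_pos fun J hJ => discr_sqrtField_singleton_mul_self_pos
          (prod_ne_zero_of_forall_not_isSquare h (Finset.mem_powerset.mp hJ))
      rw [Finset.prod_mul_distrib] at h₂
      exact pos_of_mul_pos_left h₂ h₁.le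
    have hpos' := discr_sqrtField_image_pos (Ω := Ω) h (Or.inl hs)
    omega

end DiscriminantFormula

/-! ### Transfer to subfields of ℂ -/

theorem quadraticField_eq_sqrtField (b : ℤ) : quadraticField b = sqrtField ℂ {b} := by
  simp [quadraticField, sqrtField]

theorem multiquadraticField_eq_sqrtField {n : ℕ} (a : Fin n → ℤ) :
    multiquadraticField a = sqrtField ℂ (Finset.univ.image a) := by
  simp [multiquadraticField, sqrtField]

theorem lemma5p3 (n : ℕ) (a : Fin n → ℤ) (ha : ∀ i, a i ≠ 0) (hindep : MultIndepModSquares a) :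
    NumberField.discr (multiquadraticField a) =
        ∏ J : Finset (Fin n) with J.Nonempty,
          NumberField.discr (quadraticField (subsetProd a J)) ∧
      ((2 ≤ n ∨ ∀ i, 0 < a i) → 0 < NumberField.discr (multiquadraticField a)) := by
  have h : ∀ J ⊆ (Finset.univ : Finset (Fin n)), J.Nonempty → ¬ IsSquare (∏ j ∈ J, a j) :=
    fun J _ hJ => hindep J hJ
  rw [discr_congr (multiquadraticField_eq_sqrtField a)]
  refine ⟨?_, fun hn => discr_sqrtField_image_pos h (by simpa using hn)⟩
  rw [discr_sqrtField_image h, Finset.powerset_univ]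
  symm
  have hq : ∀ J : Finset (Fin n), NumberField.discr (quadraticField (subsetProd a J)) =
      NumberField.discr (sqrtField ℂ {∏ j ∈ J, a j}) := fun J =>
    discr_congr (quadraticField_eq_sqrtField _)
  rw [Finset.prod_congr rfl fun J _ => hq J]
  -- The only extra factor belongs to J = ∅, where b_J = 1 and the discriminant is 1.
  refine Finset.prod_subset (Finset.filter_subset _ _) fun J _ hJ => ?_
  obtain rfl : J = ∅ := by simpa using hJ
  rw [Finset.prod_empty]
  exact discr_sqrtField_singleton_of_isSquare ℂ IsSquare.one
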